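/- **Conventions.** Let $A$ be a C$^*$-algebra. $M(A)$ is its multiplier algebra and $\tilde B$ denotes the unitization of a C$^*$-algebra $B$. $\mathrm{Aut}(A)$ carries the topology of pointwise norm convergence; an automorphism is inner if it is of the form $\mathrm{Ad}(u)(a)=uau^*$ with $u$ a unitary of $M(A)$, approximately inner if it lies in the closure of the inner automorphisms, and $\varphi,\psi\in\mathrm{Aut}(A)$ are approximately unitarily equivalent if $\varphi\circ\psi^{-1}$ is approximately inner. $A$ has almost stable rank one if $B\subseteq\overline{\mathrm{GL}(\tilde B)}$ for every $\sigma$-unital hereditary C$^*$-subalgebra $B\subseteq A\otimes\mathbb K$, where $\mathbb K$ is the algebra of compact operators on $\ell^2(\mathbb N)$. Put $A^\infty=\ell^\infty(\mathbb N,A)/c_0(A)$, regard $A\subseteq A^\infty$ as constant sequences, and let $A_\infty=A^\infty\cap A'$, $\mathrm{Ann}(A,A^\infty)=\{x\in A_\infty : xa=0\ \text{for all } a\in A\}$ and $F(A)=A_\infty/\mathrm{Ann}(A,A^\infty)$. Automorphisms of $A$ act on $F(A)$ termwise. If $A$ is $\sigma$-unital (in particular if $A$ is separable), $F(A)$ is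 unital, and an action $\alpha$ of a finite group $G$ on $A$ (a homomorphism $G\to\mathrm{Aut}(A)$) has the Rohlin property if there are mutually orthogonal projections $(e_g)_{g\in G}$ in $F(A)$ with $\sum_{g\in G}e_g=1$ and $\alpha_g(e_h)=e_{gh}$ for all $g,h\in G$. **Theorem.** Let $A$ be a separable C$^*$-algebra with almost stable rank one, and let $\alpha$ and $\beta$ be actions of a finite group $G$ on $A$ with the Rohlin property. Assume that $\alpha_g$ and $\beta_g$ are approximately unitarily equivalent for every $g\in G$. Then there exists an approximately inner automorphism $\theta$ of $A$ such that $$\theta\circ\alpha_g\circ\theta^{-1}=\beta_g\qquad\text{for all } g\in G.$$ -/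

import Mathlib

open scoped ENNReal Topology MultiplierAlgebra

universe u

noncomputable section

/-! ### Quotients of star rings by two-sided ideals -/

namespace TwoSidedIdeal

variable {R S : Type*} [NonUnitalRing R] [NonUnitalRing S]

/-- The quotient of a (non-unital) ring by a two-sided ideal. -/
abbrev Quot (I : TwoSidedIdeal R) : Type _ := I.ringCon.Quotient

/-- The involution on the quotient of a star ring by a self-adjoint two-sided ideal. -/
abbrev quotStarRing [StarRing R] (I : TwoSidedIdeal R) (hI : ∀ x ∈ I, star x ∈ I) :
    StarRing I.Quot where
  star := Quotient.map' star fun a b hab => by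
    have h : a - b ∈ I := (I.rel_iff a b).1 hab
    exact (I.rel_iff _ _).2 (by simpa using hI _ h)
  star_involutive := by
    rintro ⟨a⟩
    exact congrArg (fun x : R => (x : I.ringCon.Quotient)) (star_star a)
  star_mul := by
    rintro ⟨a⟩ ⟨b⟩
    exact congrArg (fun x : R => (x : I.ringCon.Quotient)) (star_mul a b)
  star_add := by
    rintro ⟨a⟩ ⟨b⟩
    exact congrArg (fun x : R => (x : I.ringCon.Quotient)) (star_add a b)

/-- The homomorphism between quotients induced by a homomorphism mapping `I` into `J`. -/
def quotMap (I : TwoSidedIdeal R) (J : TwoSidedIdeal S) (f : R →ₙ+* S)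
    (hf : ∀ x ∈ I, f x ∈ J) : I.Quot →ₙ+* J.Quot where
  toFun := Quotient.map' f fun a b hab => by
    have h : a - b ∈ I := (I.rel_iff a b).1 hab
    exact (J.rel_iff _ _).2 (by simpa using hf _ h)
  map_zero' := congrArg (fun x : S => (x : J.ringCon.Quotient)) (map_zero f)
  map_add' := by
    rintro ⟨a⟩ ⟨b⟩
    exact congrArg (fun x : S => (x : J.ringCon.Quotient)) (map_add f a b)
  map_mul' := by
    rintro ⟨a⟩ ⟨b⟩
    exact congrArg (fun x : S => (x : J.ringCon.Quotient)) (map_mul f a b)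

end TwoSidedIdeal

/-! ### Kirchberg's central sequence algebra -/

namespace CentralSequence

variable (A : Type u) [NonUnitalCStarAlgebra A]

/-- `ℓ^∞(ℕ, A)`: bounded sequences in `A` with pointwise operations. -/
abbrev BddSeq : Type u := lp (fun _ : ℕ => A) ∞

/-- `c₀(A)`: the ideal of sequences converging to zero in norm. -/
def c0 : TwoSidedIdeal (BddSeq A) :=
  TwoSidedIdeal.mk' {a | Filter.Tendsto (fun n => ‖a n‖) Filter.atTop (𝓝 0)}
    (by simp)
    (by
      intro x y hx hy
      refine squeeze_zero (fun n => norm_nonneg _) (fun n => norm_add_le (x n) (y n)) ?_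
      simpa using Filter.Tendsto.add hx hy)
    (by
      intro x hx
      simpa using hx)
    (by
      intro x y hy
      refine squeeze_zero (g := fun n => ‖x‖ * ‖y n‖) (fun n => norm_nonneg _) (fun n => ?_) ?_
      · exact (norm_mul_le (x n) (y n)).trans (mul_le_mul_of_nonneg_right
          (lp.norm_apply_le_norm ENNReal.top_ne_zero x n) (norm_nonneg _))
      · simpa using Filter.Tendsto.const_mul ‖x‖ hy)
    (by
      intro x y hx
      refine squeeze_zero (g := fun n => ‖x n‖ * ‖y‖) (fun n => norm_nonneg _) (fun n => ?_) ?_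
      · exact (norm_mul_le (x n) (y n)).trans (mul_le_mul_of_nonneg_left
          (lp.norm_apply_le_norm ENNReal.top_ne_zero y n) (norm_nonneg _))
      · simpa using Filter.Tendsto.mul_const ‖y‖ hx)

variable {A} in
theorem mem_c0 {a : BddSeq A} :
    a ∈ c0 A ↔ Filter.Tendsto (fun n => ‖a n‖) Filter.atTop (𝓝 0) :=
  TwoSidedIdeal.mem_mk' ..

/-- The sequence algebra `A^∞ = ℓ^∞(ℕ, A) / c₀(A)`.  Only its structure of a star ring is recorded,
which is all that is needed to speak about projections, partitions of unity and automorphisms. -/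
abbrev SeqAlg : Type u := (c0 A).Quot

instance : StarRing (SeqAlg A) :=
  (c0 A).quotStarRing fun x hx => mem_c0.2 (by simpa using mem_c0.1 hx)

variable {A} in
/-- The constant sequence with value `a`. -/
def constSeq (a : A) : BddSeq A :=
  ⟨fun _ => a, memℓp_infty_iff.2 ⟨‖a‖, by rintro _ ⟨_, rfl⟩; exact le_rfl⟩⟩

variable {A} in
/-- The embedding of `A` into `A^∞` as classes of constant sequences. -/
def const (a : A) : SeqAlg A := ((constSeq a : BddSeq A) : (c0 A).ringCon.Quotient)

/-- `A_∞ = A^∞ ∩ A'`, the commutant of (the constant sequences) `A` in `A^∞`. -/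
def Comm : NonUnitalSubring (SeqAlg A) :=
  NonUnitalSubring.centralizer (Set.range (const : A → SeqAlg A))

variable {A} in
theorem star_const (a : A) : star (const a) = const (star a) := rfl

instance : StarRing (Comm A) where
  star x := ⟨star (x : SeqAlg A), by
    refine NonUnitalSubring.mem_centralizer_iff.2 ?_
    rintro _ ⟨a, rfl⟩
    have h := (NonUnitalSubring.mem_centralizer_iff.1 x.2) (const (star a)) ⟨_, rfl⟩
    simpa [star_const] using (congrArg star h).symm⟩
  star_involutive x := Subtype.ext (star_star (x : SeqAlg A))
  star_mul x y := Subtype.ext (star_mul (x : SeqAlg A) y)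
  star_add x y := Subtype.ext (star_add (x : SeqAlg A) y)

variable {A} in
theorem const_mul_comm (x : Comm A) (b : A) : const b * (x : SeqAlg A) = x * const b :=
  (NonUnitalSubring.mem_centralizer_iff.1 x.2) (const b) ⟨b, rfl⟩

/-- `Ann(A, A^∞) = {x ∈ A_∞ | x b = 0 for all b ∈ A}`, an ideal of `A_∞`. -/
def Ann : TwoSidedIdeal (Comm A) :=
  TwoSidedIdeal.mk' {x | ∀ b : A, (x : SeqAlg A) * const b = 0}
    (by intro b; simp)
    (by
      intro x y hx hy b
      simp [add_mul, hx b, hy b])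
    (by
      intro x hx b
      simp [hx b])
    (by
      intro x y hy b
      simp [mul_assoc, hy b])
    (by
      intro x y hx b
      simp [mul_assoc, ← const_mul_comm y b, ← mul_assoc (x : SeqAlg A) (const b), hx b])

variable {A} in
theorem mem_Ann {x : Comm A} : x ∈ Ann A ↔ ∀ b : A, (x : SeqAlg A) * const b = 0 :=
  TwoSidedIdeal.mem_mk' ..

/-- Kirchberg's central sequence algebra `F(A) = A_∞ / Ann(A, A^∞)`. -/
abbrev F : Type u := (Ann A).Quot

instance : StarRing (F A) :=
  (Ann A).quotStarRing fun x hx => mem_Ann.2 fun b => by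
    have h : star ((x : SeqAlg A) * const (star b)) = 0 := by rw [mem_Ann.1 hx, star_zero]
    rw [star_mul, star_const, star_star] at h
    exact (const_mul_comm (star x) b).symm.trans h

variable {A}

/-- The map on bounded sequences obtained by applying an automorphism of `A` termwise. -/
def mapBddSeq (φ : A ≃⋆ₐ[ℂ] A) : BddSeq A →ₙ+* BddSeq A where
  toFun a := ⟨fun n => φ (a n), memℓp_infty_iff.2 ⟨‖a‖, by
    rintro _ ⟨n, rfl⟩
    exact (NonUnitalStarAlgHom.norm_map φ φ.injective (a n)).le.trans
      (lp.norm_apply_le_norm ENNReal.top_ne_zero a n)⟩⟩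
  map_zero' := lp.ext (funext fun _ => map_zero φ)
  map_add' a b := lp.ext (funext fun n => map_add φ (a n) (b n))
  map_mul' a b := lp.ext (funext fun n => map_mul φ (a n) (b n))

/-- The map on `A^∞` induced by an automorphism of `A`. -/
def mapSeqAlg (φ : A ≃⋆ₐ[ℂ] A) : SeqAlg A →ₙ+* SeqAlg A :=
  TwoSidedIdeal.quotMap (c0 A) (c0 A) (mapBddSeq φ) fun a ha => mem_c0.2 (by
    refine (mem_c0.1 ha).congr fun n => ?_
    exact (NonUnitalStarAlgHom.norm_map φ φ.injective (a n)).symm)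

theorem mapSeqAlg_const (φ : A ≃⋆ₐ[ℂ] A) (a : A) : mapSeqAlg φ (const a) = const (φ a) := rfl

/-- The map on `A_∞` induced by an automorphism of `A`. -/
def mapComm (φ : A ≃⋆ₐ[ℂ] A) : Comm A →ₙ+* Comm A :=
  NonUnitalRingHom.codRestrict ((mapSeqAlg φ).comp (NonUnitalSubringClass.subtype (Comm A)))
    (Comm A) fun x => by
      refine NonUnitalSubring.mem_centralizer_iff.2 ?_
      rintro _ ⟨a, rfl⟩
      have h := congrArg (mapSeqAlg φ) (const_mul_comm x (φ.symm a))
      simpa [mapSeqAlg_const] using h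

/-- The map on `F(A)` induced by an automorphism of `A`. -/
def mapF (φ : A ≃⋆ₐ[ℂ] A) : F A →ₙ+* F A :=
  TwoSidedIdeal.quotMap (Ann A) (Ann A) (mapComm φ) fun x hx => mem_Ann.2 fun b => by
    have h := congrArg (mapSeqAlg φ) (mem_Ann.1 hx (φ.symm b))
    rw [map_mul, map_zero, mapSeqAlg_const, StarAlgEquiv.apply_symm_apply] at h
    exact h

end CentralSequence

/-- The Rohlin property of an action `α` of a finite group `G` on `A`: there is a partition of
unity `(e_g)` in `F(A)` consisting of (mutually orthogonal) projections with `α_g(e_h) = e_{gh}`.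
That the sum is the unit of `F(A)` is expressed by saying that it is a two-sided identity. -/
def HasRohlinProperty {A : Type u} [NonUnitalCStarAlgebra A] {G : Type*} [Group G] [Fintype G]
    (α : G →* (A ≃⋆ₐ[ℂ] A)) : Prop :=
  ∃ e : G → CentralSequence.F A,
    (∀ g, IsStarProjection (e g)) ∧
    (∀ g h, g ≠ h → e g * e h = 0) ∧
    (∀ x, (∑ g, e g) * x = x ∧ x * (∑ g, e g) = x) ∧
    (∀ g h, CentralSequence.mapF (α g) (e h) = e (g * h))

/-! ### Inner and approximately inner automorphisms -/

section Aut

variable {A : Type u} [NonUnitalCStarAlgebra A]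

/-- `φ = Ad(u)` for a unitary `u` of the multiplier algebra `M(A)`; the equation
`φ(a) = u a u*` is read in `M(A)`. -/
def IsInnerAut (φ : A ≃⋆ₐ[ℂ] A) : Prop :=
  ∃ u ∈ unitary 𝓜(ℂ, A), ∀ a : A,
    DoubleCentralizer.coe ℂ (φ a) = u * DoubleCentralizer.coe ℂ a * star u

variable (A) in
/-- The topology of pointwise norm convergence on `Aut(A)`. -/
abbrev pointNormTopology : TopologicalSpace (A ≃⋆ₐ[ℂ] A) :=
  TopologicalSpace.induced (fun φ => (φ : A → A)) inferInstance

/-- `φ` lies in the closure of the inner automorphisms for pointwise norm convergence. -/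
def IsApproxInner (φ : A ≃⋆ₐ[ℂ] A) : Prop :=
  φ ∈ closure[pointNormTopology A] {ψ | IsInnerAut ψ}

/-- Approximate unitary equivalence of automorphisms. -/
def IsApproxUnitarilyEquiv (φ ψ : A ≃⋆ₐ[ℂ] A) : Prop :=
  IsApproxInner (φ * ψ⁻¹)

end Aut

/-! ### Almost stable rank one -/

section Hereditary

variable {D : Type*} [NonUnitalCStarAlgebra D]

/-- `B` is a hereditary C⋆-subalgebra of the C⋆-algebra `S` (both inside `D`). -/
structure IsHereditaryIn [PartialOrder D] (S B : NonUnitalStarSubalgebra ℂ D) : Prop where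
  le : B ≤ S
  isClosed : IsClosed (B : Set D)
  mem_of_le : ∀ x ∈ S, ∀ b ∈ B, 0 ≤ x → x ≤ b → x ∈ B

/-- `B` is σ-unital: it has a countable approximate unit (of positive contractions). -/
def IsSigmaUnital [PartialOrder D] (B : NonUnitalStarSubalgebra ℂ D) : Prop :=
  ∃ h : ℕ → D, (∀ n, h n ∈ B ∧ 0 ≤ h n ∧ ‖h n‖ ≤ 1) ∧
    ∀ b ∈ B, Filter.Tendsto (fun n => h n * b) Filter.atTop (𝓝 b) ∧
      Filter.Tendsto (fun n => b * h n) Filter.atTop (𝓝 b)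

end Hereditary

/-- `B ⊆ closure GL(B̃)`: each element of the C⋆-algebra `B` is a norm limit of invertible elements
of its unitization. -/
def SubsetClosureGL (B : Type*) [NonUnitalCStarAlgebra B] : Prop :=
  ∀ b : B, (b : Unitization ℂ B) ∈ closure {z : Unitization ℂ B | IsUnit z}

section Stabilization

variable {A : Type u} [NonUnitalCStarAlgebra A]
  {H : Type u} [NormedAddCommGroup H] [InnerProductSpace ℂ H] [CompleteSpace H]

/-- The operator `π(a) ⊗ e_{ij}` on `H ⊗ ℓ²(ℕ) = ℓ²(ℕ, H)`. -/
def tensorMatrixUnit (π : A →⋆ₙₐ[ℂ] (H →L[ℂ] H)) (a : A) (i j : ℕ) :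
    lp (fun _ : ℕ => H) 2 →L[ℂ] lp (fun _ : ℕ => H) 2 :=
  lp.singleContinuousLinearMap ℂ (fun _ : ℕ => H) 2 i ∘L π a ∘L
    lp.evalCLM ℂ (fun _ : ℕ => H) 2 j

/-- The C⋆-algebra `A ⊗ 𝕂`, realised on `ℓ²(ℕ, H)` by means of a representation `π` of `A`
on `H`: the C⋆-algebra generated by the operators `π(a) ⊗ e_{ij}`.  It is the (spatial) tensor
product `A ⊗ 𝕂` whenever `π` is faithful. -/
def stabilization (π : A →⋆ₙₐ[ℂ] (H →L[ℂ] H)) :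
    NonUnitalStarSubalgebra ℂ (lp (fun _ : ℕ => H) 2 →L[ℂ] lp (fun _ : ℕ => H) 2) :=
  (NonUnitalStarAlgebra.adjoin ℂ
    {T | ∃ (a : A) (i j : ℕ), T = tensorMatrixUnit π a i j}).topologicalClosure

end Stabilization

/-- `A` has almost stable rank one: `B ⊆ closure GL(B̃)` for every σ-unital hereditary
subalgebra `B` of `A ⊗ 𝕂`.  Here `A ⊗ 𝕂` is formed, as the spatial tensor product, with a
faithful representation `π` of `A` on a Hilbert space; such a `π` exists for every `A`, and
up to isomorphism `A ⊗ 𝕂` does not depend on it. -/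
def AlmostStableRankOne (A : Type u) [NonUnitalCStarAlgebra A] : Prop :=
  ∃ (H : Type u) (_ : NormedAddCommGroup H) (_ : InnerProductSpace ℂ H) (_ : CompleteSpace H)
    (π : A →⋆ₙₐ[ℂ] (H →L[ℂ] H)), Function.Injective π ∧
    ∀ (B : NonUnitalStarSubalgebra ℂ (lp (fun _ : ℕ => H) 2 →L[ℂ] lp (fun _ : ℕ => H) 2))
      (hB : IsHereditaryIn (stabilization π) B), IsSigmaUnital B →
      haveI : IsClosed (B : Set (lp (fun _ : ℕ => H) 2 →L[ℂ] lp (fun _ : ℕ => H) 2)) := hB.isClosed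
      SubsetClosureGL B

end

/-! The proof is an approximate intertwining argument whose basic move is averaging over the Rohlin
projections. If `θ` is approximately inner, then each `φ_h = β_h θ α_h⁻¹ θ⁻¹` is approximately
inner, because the approximately inner automorphisms form a normal subgroup and `α_h` is
approximately unitarily equivalent to `β_h`. Let `e_h(n)` be sequences in `A` representing Rohlin
projections for `β`. Since `β_g(e_h) = e_{gh}`, the maps `x ↦ ∑ e_h(n) φ_h(θ x)` asymptotically
intertwine `α` and `β`, and they differ from `θ` by at most a constant times the failure of `θ` to
intertwine, up to an error tending to zero.

Such a sum must be replaced by an honest automorphism. If `φ_h` is close to `Ad(u_h)`, the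
multiplier `z_n = ∑ e_h(n) u_h` lies in `A`, asymptotically acts on `A` as a unitary, and
conjugation by it is asymptotically the required sum. Almost stable rank one, applied to the corner
`A` of `A ⊗ 𝕂` (σ-unital since `A` is separable), makes `z_n` a limit of invertible multipliers. The
unitary polar part of a nearby invertible then does the same job (`IsRohlinSeq.exists_unitary`,
`IsRohlinSeq.eventually_exists_isInnerAut`).

One averaging (`IsRohlinSeq.exists_intertwining`) makes `θ` nearly intertwining on a finite set, but
says nothing of the kind about `θ⁻¹` on that set. A second averaging, with `α` and `β` exchanged and
applied to `θ⁻¹`, repairs this without spoiling the first (`exists_approx_intertwining`). Iteration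
with geometric tolerances along a dense sequence makes both `θ_n` and `θ_n⁻¹` pointwise Cauchy, and
the limit is an automorphism that intertwines exactly. -/

open Filter

/-! ### Unitary polar parts of invertible elements -/

/-- An invertible element `y` of a unital C⋆-algebra with `y⋆y` close to acting trivially on `x` has
a unitary part acting on `x` like `y`. -/
theorem IsUnit.exists_unitary_norm_mul_sub_mul_le {M : Type*} [CStarAlgebra M] {y : M}
    (hy : IsUnit y) :
    ∃ U ∈ unitary M, ∀ x, ‖U * x - y * x‖ ≤ ‖x - star y * y * x‖ := by
  obtain ⟨p, hp⟩ : ∃ p, p = star y * y := ⟨_, rfl⟩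
  have hpsa : IsSelfAdjoint p := hp ▸ .star_mul_self y
  have hpu : IsUnit p := hp ▸ hy.star.mul hy
  have h0 : ∀ t ∈ spectrum ℝ p, 0 < t := fun t ht =>
    lt_of_le_of_ne (spectrum_star_mul_self_nonneg t (hp ▸ ht)) fun h =>
      spectrum.zero_notMem ℝ hpu (h ▸ ht)
  have hsq : ContinuousOn (fun t : ℝ => (√t)⁻¹) (spectrum ℝ p) :=
    ContinuousOn.inv₀ (by fun_prop) fun t ht => (Real.sqrt_pos.2 (h0 t ht)).ne'
  have hcc : ContinuousOn (fun t : ℝ => (1 + √t)⁻¹) (spectrum ℝ p) :=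
    ContinuousOn.inv₀ (by fun_prop) fun t ht => by positivity
  have hsps : cfc (fun t : ℝ => (√t)⁻¹) p * (cfc (fun t : ℝ => t) p * cfc (fun t : ℝ => (√t)⁻¹) p)
      = 1 := by
    rw [← cfc_mul _ _ p (by fun_prop) hsq, ← cfc_mul _ _ p hsq (by fun_prop), ← cfc_one ℝ p]
    refine cfc_congr fun t ht => ?_
    have := Real.sqrt_pos.2 (h0 t ht)
    have h2 := Real.mul_self_sqrt (h0 t ht).le
    simp only [Pi.one_apply]
    field_simp
    nlinarith
  -- With `s = p^{-1/2}` and `c = (1 + √p)⁻¹`, this factorization gives `Ux - yx = U c (x - px)` for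
  -- `U = ys`. As `‖c‖ ≤ 1`, the estimate needs no bound on `y⁻¹`.
  have hsc : cfc (1 : ℝ → ℝ) p - cfc (fun t : ℝ => (√t)⁻¹) p =
      cfc (fun t : ℝ => (√t)⁻¹) p * cfc (fun t : ℝ => (1 + √t)⁻¹) p *
        (cfc (fun t : ℝ => t) p - cfc (1 : ℝ → ℝ) p) := by
    rw [← cfc_mul _ _ p hsq hcc, ← cfc_sub (fun t : ℝ => t) 1 p (by fun_prop) (by fun_prop),
      ← cfc_sub 1 _ p (by fun_prop) hsq,
      ← cfc_mul (fun t : ℝ => (√t)⁻¹ * (1 + √t)⁻¹) (fun t => t - (1 : ℝ → ℝ) t) p (hsq.mul hcc)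
        (by fun_prop)]
    refine cfc_congr fun t ht => ?_
    have := Real.sqrt_pos.2 (h0 t ht)
    have h2 := Real.mul_self_sqrt (h0 t ht).le
    simp only [Pi.one_apply]
    field_simp
    nlinarith
  have hcn : ‖cfc (fun t : ℝ => (1 + √t)⁻¹) p‖ ≤ 1 := norm_cfc_le zero_le_one fun t ht => by
    rw [Real.norm_of_nonneg (by positivity)]
    exact inv_le_one_of_one_le₀ (by linarith [Real.sqrt_nonneg t])
  have hssa : star (cfc (fun t : ℝ => (√t)⁻¹) p) = cfc (fun t : ℝ => (√t)⁻¹) p :=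
    IsSelfAdjoint.star_eq (cfc_predicate _ _)
  rw [cfc_id' ℝ p] at hsps hsc
  rw [cfc_one ℝ p] at hsc
  generalize cfc (fun t : ℝ => (√t)⁻¹) p = s at *
  generalize cfc (fun t : ℝ => (1 + √t)⁻¹) p = c at *
  have hU1 : star (y * s) * (y * s) = 1 := by
    rw [star_mul, hssa, ← hsps, hp]; noncomm_ring
  have hsu : IsUnit s :=
    isUnit_iff_exists_and_exists.2 ⟨⟨_, hsps⟩, ⟨s * p, by rw [mul_assoc, hsps]⟩⟩
  have hU : y * s ∈ unitary M := by
    refine Unitary.mem_iff.2 ⟨hU1, ?_⟩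
    obtain ⟨v, hv⟩ := hy.mul hsu
    rw [← hv] at hU1 ⊢
    rw [Units.mul_eq_one_iff_eq_inv] at hU1
    rw [hU1, Units.mul_inv]
  refine ⟨y * s, hU, fun x => ?_⟩
  have : y * s * x - y * x = y * s * (c * (x - p * x)) := by
    have : y * s * x - y * x = - (y * (1 - s) * x) := by noncomm_ring
    rw [this, hsc]; noncomm_ring
  rw [this, CStarRing.norm_mem_unitary_mul _ hU, ← hp]
  calc _ ≤ ‖c‖ * ‖x - p * x‖ := norm_mul_le _ _
    _ ≤ _ := mul_le_of_le_one_left (norm_nonneg _) hcn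

/-! ### Calculus of asymptotically equal sequences -/

section Null

variable {R : Type*} [NonUnitalCStarAlgebra R]

/-- Two sequences are asymptotically equal if their difference tends to zero. -/
def AsympEq (f g : ℕ → R) : Prop := Tendsto (fun n => f n - g n) atTop (𝓝 0)

/-- A sequence bounded in norm. -/
def NormBdd (f : ℕ → R) : Prop := ∃ C, ∀ n, ‖f n‖ ≤ C

theorem NormBdd.const (a : R) : NormBdd fun _ => a := ⟨‖a‖, fun _ => le_rfl⟩

theorem NormBdd.star {f : ℕ → R} (hf : NormBdd f) : NormBdd fun n => star (f n) :=
  hf.imp fun _ h n => by simpa using h n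

theorem NormBdd.mul {f g : ℕ → R} (hf : NormBdd f) (hg : NormBdd g) :
    NormBdd fun n => f n * g n := by
  obtain ⟨C, hC⟩ := hf
  obtain ⟨D, hD⟩ := hg
  exact ⟨C * D, fun n => (norm_mul_le _ _).trans
    (mul_le_mul (hC n) (hD n) (norm_nonneg _) ((norm_nonneg _).trans (hC n)))⟩

theorem NormBdd.sum {ι : Type*} (s : Finset ι) {f : ι → ℕ → R} (hf : ∀ i ∈ s, NormBdd (f i)) :
    NormBdd fun n => ∑ i ∈ s, f i n := by
  choose! C hC using hf
  exact ⟨∑ i ∈ s, C i, fun n => norm_sum_le_of_le _ fun i hi => hC i hi n⟩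

theorem NormBdd.unitary {M : Type*} [CStarAlgebra M] {U : ℕ → M} (hU : ∀ n, U n ∈ unitary M) :
    NormBdd U :=
  -- The bound `‖1‖` avoids assuming that `M` is nontrivial.
  ⟨‖(1 : M)‖, fun n => by
    have := CStarRing.norm_mem_unitary_mul (1 : M) (hU n)
    rw [mul_one] at this
    exact this.le⟩

namespace AsympEq

theorem of_eq {f g : ℕ → R} (h : ∀ n, f n = g n) : AsympEq f g := by simp [AsympEq, h]

theorem symm {f g : ℕ → R} (h : AsympEq f g) : AsympEq g f := by
  simpa [AsympEq] using h.neg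

theorem trans {f g k : ℕ → R} (h : AsympEq f g) (h' : AsympEq g k) : AsympEq f k := by
  simpa [AsympEq] using h.add h'

theorem sum {ι : Type*} (s : Finset ι) {f g : ι → ℕ → R} (h : ∀ i ∈ s, AsympEq (f i) (g i)) :
    AsympEq (fun n => ∑ i ∈ s, f i n) (fun n => ∑ i ∈ s, g i n) := by
  have := tendsto_finsetSum s h
  simpa [AsympEq, ← Finset.sum_sub_distrib] using this

theorem star {f g : ℕ → R} (h : AsympEq f g) :
    AsympEq (fun n => star (f n)) (fun n => star (g n)) := by
  have := Tendsto.star h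
  simpa [AsympEq] using this

theorem mul_left {f g k : ℕ → R} (h : AsympEq f g) (hk : NormBdd k) :
    AsympEq (fun n => k n * f n) (fun n => k n * g n) := by
  obtain ⟨C, hC⟩ := hk
  refine squeeze_zero_norm (a := fun n => C * ‖f n - g n‖) (fun n => ?_) ?_
  · rw [← mul_sub]
    exact (norm_mul_le _ _).trans (mul_le_mul_of_nonneg_right (hC n) (norm_nonneg _))
  · simpa using (Tendsto.norm h).const_mul C

theorem mul_right {f g k : ℕ → R} (h : AsympEq f g) (hk : NormBdd k) :
    AsympEq (fun n => f n * k n) (fun n => g n * k n) := by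
  obtain ⟨C, hC⟩ := hk
  refine squeeze_zero_norm (a := fun n => ‖f n - g n‖ * C) (fun n => ?_) ?_
  · rw [← sub_mul]
    exact (norm_mul_le _ _).trans (mul_le_mul_of_nonneg_left (hC n) (norm_nonneg _))
  · simpa using (Tendsto.norm h).mul_const C

theorem map {S F : Type*} [NonUnitalCStarAlgebra S] [FunLike F R S] [AddMonoidHomClass F R S]
    {φ : F} (hφ : Continuous φ) {f g : ℕ → R} (h : AsympEq f g) :
    AsympEq (fun n => φ (f n)) (fun n => φ (g n)) := by
  have := (hφ.tendsto 0).comp h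
  simpa [AsympEq, Function.comp_def, map_sub, map_zero] using this

end AsympEq

end Null

/-- A bounded sequence in the closure of the invertibles that is asymptotically isometric on `x` and
`x⋆` can be replaced by a sequence of unitaries. -/
theorem exists_unitary_asympEq_conj {M : Type*} [CStarAlgebra M] {z : ℕ → M}
    (hz : ∀ n, z n ∈ closure {y : M | IsUnit y}) (hb : NormBdd z) :
    ∃ U : ℕ → M, (∀ n, U n ∈ unitary M) ∧ ∀ x : M,
      AsympEq (fun n => star (z n) * z n * x) (fun _ => x) →
      AsympEq (fun n => star (z n) * z n * star x) (fun _ => star x) →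
      AsympEq (fun n => U n * x * star (U n)) (fun n => z n * x * star (z n)) := by
  have hy : ∀ n, ∃ y : M, IsUnit y ∧ ‖z n - y‖ < 1 / ((n : ℝ) + 1) := fun n => by
    obtain ⟨y, hy, h⟩ := Metric.mem_closure_iff.1 (hz n) (1 / ((n : ℝ) + 1)) (by positivity)
    exact ⟨y, hy, by rwa [dist_eq_norm] at h⟩
  choose y hyu hyz using hy
  choose U hU hUy using fun n => (hyu n).exists_unitary_norm_mul_sub_mul_le
  have hzy : AsympEq z y := squeeze_zero_norm (fun n => (hyz n).le)
    tendsto_one_div_add_atTop_nhds_zero_nat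
  have hyb : NormBdd y := by
    obtain ⟨C, hC⟩ := hb
    refine ⟨C + 1, fun n => ?_⟩
    have h1 : 1 / ((n : ℝ) + 1) ≤ 1 := by
      rw [div_le_one (by positivity)]; linarith [n.cast_nonneg (α := ℝ)]
    calc ‖y n‖ = ‖z n - (z n - y n)‖ := by simp
      _ ≤ C + 1 := (norm_sub_le _ _).trans (add_le_add (hC n) ((hyz n).le.trans h1))
  have key : ∀ x : M, AsympEq (fun n => star (z n) * z n * x) (fun _ => x) →
      AsympEq (fun n => U n * x) (fun n => z n * x) := fun x hx => by
    have h1 : AsympEq (fun _ => x) (fun n => star (y n) * y n * x) := by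
      refine hx.symm.trans (.mul_right (.trans (hzy.mul_left hb.star) ?_) (.const x))
      exact hzy.star.mul_right hyb
    refine AsympEq.trans (g := fun n => y n * x) ?_ (hzy.symm.mul_right (.const x))
    exact squeeze_zero_norm (fun n => hUy n x) (by simpa using Tendsto.norm h1)
  refine ⟨U, hU, fun x hx hx' => ?_⟩
  refine ((key x hx).mul_right (NormBdd.unitary hU).star).trans ?_
  -- The right factor is controlled by taking adjoints in the estimate for `star x`; this is why the
  -- hypothesis is needed at both `x` and `star x`.
  have h2 : AsympEq (fun n => x * star (U n)) (fun n => x * star (z n)) := by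
    simpa using (key _ hx').star
  simpa [mul_assoc] using h2.mul_left hb

/-! ### Multipliers, with `A` as an ideal of `M(A)` -/

namespace DoubleCentralizer

variable {A : Type u} [NonUnitalCStarAlgebra A]

theorem coe_injective : Function.Injective (DoubleCentralizer.coe ℂ : A → 𝓜(ℂ, A)) := by
  refine (injective_iff_map_eq_zero (DoubleCentralizer.coeHom (𝕜 := ℂ) (A := A))).2 fun a ha => ?_
  have h : a * star a = 0 := by
    have := congrArg (fun m : 𝓜(ℂ, A) => m.fst (star a)) ha
    simpa using this
  exact CStarRing.mul_star_self_eq_zero_iff a |>.1 h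

theorem norm_coe (a : A) : ‖DoubleCentralizer.coe ℂ a‖ = ‖a‖ :=
  NonUnitalStarAlgHom.norm_map (DoubleCentralizer.coeHom (𝕜 := ℂ) (A := A)) coe_injective a

theorem continuous_coe : Continuous (DoubleCentralizer.coe ℂ : A → 𝓜(ℂ, A)) :=
  (NonUnitalStarAlgHom.isometry (DoubleCentralizer.coeHom (𝕜 := ℂ) (A := A))
    coe_injective).continuous

theorem coe_mul (a b : A) :
    DoubleCentralizer.coe ℂ (a * b) = DoubleCentralizer.coe ℂ a * DoubleCentralizer.coe ℂ b :=
  map_mul (coeHom (𝕜 := ℂ) (A := A)) a b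

theorem coe_star (a : A) :
    DoubleCentralizer.coe ℂ (star a) = star (DoubleCentralizer.coe ℂ a) :=
  map_star (coeHom (𝕜 := ℂ) (A := A)) a

theorem coe_sub (a b : A) :
    DoubleCentralizer.coe ℂ (a - b) = DoubleCentralizer.coe ℂ a - DoubleCentralizer.coe ℂ b :=
  map_sub (coeHom (𝕜 := ℂ) (A := A)) a b

theorem coe_sum {ι : Type*} (s : Finset ι) (f : ι → A) :
    DoubleCentralizer.coe ℂ (∑ i ∈ s, f i) = ∑ i ∈ s, DoubleCentralizer.coe ℂ (f i) :=
  map_sum (coeHom (𝕜 := ℂ) (A := A)) f s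

theorem mul_coe (m : 𝓜(ℂ, A)) (a : A) :
    m * DoubleCentralizer.coe ℂ a = DoubleCentralizer.coe ℂ (m.fst a) := by
  -- Centrality shows that the difference of the two sides is annihilated by every left factor, in
  -- particular by its own adjoint, so it vanishes by the C⋆-identity.
  have hl : ∀ x y, m.fst (x * y) = m.fst x * y := by
    intro x y
    have : ∀ z, z * (m.fst (x * y) - m.fst x * y) = 0 := fun z => by
      rw [mul_sub, ← mul_assoc, ← m.central, ← m.central, mul_assoc, sub_self]
    have := this (star (m.fst (x * y) - m.fst x * y))
    exact sub_eq_zero.1 (CStarRing.star_mul_self_eq_zero_iff _ |>.1 this)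
  refine DoubleCentralizer.ext ℂ A _ _ (Prod.ext ?_ ?_)
  · ext b; simp [hl]
  · ext b; simp [m.central]

theorem coe_mul' (m : 𝓜(ℂ, A)) (a : A) :
    DoubleCentralizer.coe ℂ a * m = DoubleCentralizer.coe ℂ (m.snd a) := by
  have h := congrArg star (mul_coe (star m) (star a))
  rw [star_mul, star_star, coe_star, star_star, ← coe_star, star_fst, star_star, star_star] at h
  exact h

theorem coe_snd_fst (u v : 𝓜(ℂ, A)) (a : A) :
    DoubleCentralizer.coe ℂ (v.snd (u.fst a)) = u * DoubleCentralizer.coe ℂ a * v := by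
  rw [← coe_mul', ← mul_coe]

theorem unitary_conj_cancel {M : Type*} [CStarAlgebra M] {u : M} (hu : u ∈ unitary M) (x : M) :
    star u * (u * x * star u) * u = x := by
  have h := (Unitary.mem_iff.1 hu).1
  calc _ = star u * u * x * (star u * u) := by noncomm_ring
    _ = x := by rw [h, one_mul, mul_one]

/-- The automorphism `a ↦ u a u⋆` of `A` implemented by a unitary multiplier `u`. -/
noncomputable def Ad (u : 𝓜(ℂ, A)) (hu : u ∈ unitary 𝓜(ℂ, A)) : A ≃⋆ₐ[ℂ] A where
  toFun a := (star u).snd (u.fst a)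
  invFun a := u.snd ((star u).fst a)
  left_inv a := coe_injective <| by
    rw [coe_snd_fst, coe_snd_fst, unitary_conj_cancel hu]
  right_inv a := coe_injective <| by
    have := unitary_conj_cancel (Unitary.star_mem hu) (DoubleCentralizer.coe ℂ a)
    rw [star_star] at this
    rw [coe_snd_fst, coe_snd_fst, this]
  map_mul' a b := coe_injective <| by
    rw [coe_snd_fst, coe_mul, coe_mul, coe_snd_fst, coe_snd_fst]
    calc _ = u * DoubleCentralizer.coe ℂ a * 1 * DoubleCentralizer.coe ℂ b * star u := by
          noncomm_ring
      _ = _ := by rw [← (Unitary.mem_iff.1 hu).1]; noncomm_ring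
  map_add' a b := by simp
  map_star' a := coe_injective <| by
    rw [coe_snd_fst, coe_star, coe_star, coe_snd_fst]
    simp [mul_assoc]
  map_smul' c a := by simp

theorem coe_Ad (u : 𝓜(ℂ, A)) (hu : u ∈ unitary 𝓜(ℂ, A)) (a : A) :
    DoubleCentralizer.coe ℂ (Ad u hu a) = u * DoubleCentralizer.coe ℂ a * star u :=
  coe_snd_fst ..

theorem isInnerAut_Ad (u : 𝓜(ℂ, A)) (hu : u ∈ unitary 𝓜(ℂ, A)) : IsInnerAut (Ad u hu) :=
  ⟨u, hu, coe_Ad u hu⟩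

/-- The extension of an automorphism of `A` to multipliers. -/
noncomputable def mapAut (ψ : A ≃⋆ₐ[ℂ] A) (m : 𝓜(ℂ, A)) : 𝓜(ℂ, A) :=
  have hψ (χ : A ≃⋆ₐ[ℂ] A) : Continuous χ :=
    (NonUnitalStarAlgHom.isometry χ χ.injective).continuous
  let L : (A →L[ℂ] A) := ⟨⟨⟨ψ, map_add ψ⟩, fun c x => map_smul ψ c x⟩, hψ ψ⟩
  let L' : (A →L[ℂ] A) := ⟨⟨⟨ψ.symm, map_add ψ.symm⟩, fun c x => map_smul ψ.symm c x⟩, hψ ψ.symm⟩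
  { fst := L ∘L m.fst ∘L L'
    snd := L ∘L m.snd ∘L L'
    central x y := by
      change ψ (m.snd (ψ.symm x)) * y = x * ψ (m.fst (ψ.symm y))
      have := congrArg ψ (m.central (ψ.symm x) (ψ.symm y))
      simpa using this }

theorem mapAut_fst (ψ : A ≃⋆ₐ[ℂ] A) (m : 𝓜(ℂ, A)) (a : A) :
    (mapAut ψ m).fst a = ψ (m.fst (ψ.symm a)) := rfl

theorem mapAut_snd (ψ : A ≃⋆ₐ[ℂ] A) (m : 𝓜(ℂ, A)) (a : A) :
    (mapAut ψ m).snd a = ψ (m.snd (ψ.symm a)) := rfl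

theorem mapAut_mul (ψ : A ≃⋆ₐ[ℂ] A) (m k : 𝓜(ℂ, A)) :
    mapAut ψ (m * k) = mapAut ψ m * mapAut ψ k := by
  refine DoubleCentralizer.ext ℂ A _ _ (Prod.ext ?_ ?_) <;> ext b <;>
    simp [mapAut_fst, mapAut_snd]

theorem mapAut_one (ψ : A ≃⋆ₐ[ℂ] A) : mapAut ψ 1 = 1 := by
  refine DoubleCentralizer.ext ℂ A _ _ (Prod.ext ?_ ?_) <;> ext b <;>
    simp [mapAut_fst, mapAut_snd]

theorem mapAut_star (ψ : A ≃⋆ₐ[ℂ] A) (m : 𝓜(ℂ, A)) : mapAut ψ (star m) = star (mapAut ψ m) := by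
  refine DoubleCentralizer.ext ℂ A _ _ (Prod.ext ?_ ?_) <;> ext b <;>
    simp [mapAut_fst, mapAut_snd, map_star]

theorem mapAut_coe (ψ : A ≃⋆ₐ[ℂ] A) (a : A) :
    mapAut ψ (DoubleCentralizer.coe ℂ a) = DoubleCentralizer.coe ℂ (ψ a) := by
  refine DoubleCentralizer.ext ℂ A _ _ (Prod.ext ?_ ?_) <;> ext b <;>
    simp [mapAut_fst, mapAut_snd]

theorem mapAut_mem_unitary (ψ : A ≃⋆ₐ[ℂ] A) {u : 𝓜(ℂ, A)} (hu : u ∈ unitary 𝓜(ℂ, A)) :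
    mapAut ψ u ∈ unitary 𝓜(ℂ, A) := by
  obtain ⟨h1, h2⟩ := Unitary.mem_iff.1 hu
  refine Unitary.mem_iff.2 ⟨?_, ?_⟩
  · rw [← mapAut_star, ← mapAut_mul, h1, mapAut_one]
  · rw [← mapAut_star, ← mapAut_mul, h2, mapAut_one]

end DoubleCentralizer

/-! ### The normal subgroup of approximately inner automorphisms -/

section InnerAut

open DoubleCentralizer

variable {A : Type u} [NonUnitalCStarAlgebra A]

theorem norm_aut_apply (φ : A ≃⋆ₐ[ℂ] A) (a : A) : ‖φ a‖ = ‖a‖ :=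
  NonUnitalStarAlgHom.norm_map φ φ.injective a

theorem continuous_aut (φ : A ≃⋆ₐ[ℂ] A) : Continuous φ :=
  (NonUnitalStarAlgHom.isometry φ φ.injective).continuous

theorem aut_apply_inv (φ : A ≃⋆ₐ[ℂ] A) (a : A) : φ (φ⁻¹ a) = a := φ.apply_symm_apply a

theorem aut_inv_apply (φ : A ≃⋆ₐ[ℂ] A) (a : A) : φ⁻¹ (φ a) = a := φ.symm_apply_apply a

theorem norm_aut_inv_sub (φ : A ≃⋆ₐ[ℂ] A) (a b : A) : ‖φ⁻¹ a - b‖ = ‖a - φ b‖ := by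
  rw [← norm_aut_apply φ, map_sub]
  congr 2
  exact φ.apply_symm_apply a

theorem IsInnerAut.one : IsInnerAut (1 : A ≃⋆ₐ[ℂ] A) := ⟨1, one_mem _, by simp⟩

theorem IsInnerAut.mul {φ ψ : A ≃⋆ₐ[ℂ] A} (hφ : IsInnerAut φ) (hψ : IsInnerAut ψ) :
    IsInnerAut (φ * ψ) := by
  obtain ⟨u, hu, h⟩ := hφ
  obtain ⟨v, hv, k⟩ := hψ
  exact ⟨u * v, mul_mem hu hv, fun a => by
    rw [StarAlgEquiv.mul_apply, h, k, star_mul]; noncomm_ring⟩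

theorem IsInnerAut.inv {φ : A ≃⋆ₐ[ℂ] A} (hφ : IsInnerAut φ) : IsInnerAut φ⁻¹ := by
  obtain ⟨u, hu, h⟩ := hφ
  refine ⟨star u, Unitary.star_mem hu, fun a => ?_⟩
  have := unitary_conj_cancel hu (DoubleCentralizer.coe ℂ (φ⁻¹ a))
  rw [← h] at this
  rw [star_star, ← this]
  congr 3
  exact (φ.apply_symm_apply a)

theorem IsInnerAut.conj {φ : A ≃⋆ₐ[ℂ] A} (hφ : IsInnerAut φ) (ψ : A ≃⋆ₐ[ℂ] A) :
    IsInnerAut (ψ * φ * ψ⁻¹) := by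
  obtain ⟨u, hu, h⟩ := hφ
  refine ⟨mapAut ψ u, mapAut_mem_unitary ψ hu, fun a => ?_⟩
  have := congrArg (mapAut ψ) (h (ψ⁻¹ a))
  rw [mapAut_mul, mapAut_mul, mapAut_star, mapAut_coe, mapAut_coe] at this
  rw [StarAlgEquiv.mul_apply, StarAlgEquiv.mul_apply, this]
  congr 4
  exact ψ.apply_symm_apply a

/-- Approximate innerness in terms of finite sets and `ε`. -/
theorem isApproxInner_iff {φ : A ≃⋆ₐ[ℂ] A} :
    IsApproxInner φ ↔ ∀ (F : Finset A) (ε : ℝ), 0 < ε →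
      ∃ ψ, IsInnerAut ψ ∧ ∀ x ∈ F, ‖ψ x - φ x‖ < ε := by
  have h1 : IsApproxInner φ ↔ (φ : A → A) ∈ closure ((fun ψ : A ≃⋆ₐ[ℂ] A => (ψ : A → A)) ''
      {ψ | IsInnerAut ψ}) := by
    unfold IsApproxInner pointNormTopology
    exact closure_induced
  have hb := Filter.hasBasis_pi fun a : A => Metric.nhds_basis_ball (x := φ a)
  rw [← nhds_pi] at hb
  rw [h1, mem_closure_iff_nhds_basis hb]
  constructor
  · intro h F ε hε
    obtain ⟨_, ⟨ψ, hψ, rfl⟩, hy⟩ := h ⟨F, fun _ => ε⟩ ⟨F.finite_toSet, fun _ _ => hε⟩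
    exact ⟨ψ, hψ, fun x hx => by simpa [dist_eq_norm] using hy x hx⟩
  · rintro h ⟨I, r⟩ ⟨hI, hr⟩
    have : ∀ᶠ ε in 𝓝[>] (0 : ℝ), ∀ i ∈ I, ε < r i :=
      (Filter.eventually_all_finite hI).2 fun i hi =>
        eventually_nhdsWithin_of_eventually_nhds (eventually_lt_nhds (hr i hi))
    obtain ⟨ε, hε, hε0⟩ := (this.and self_mem_nhdsWithin).exists
    obtain ⟨ψ, hψ, h⟩ := h hI.toFinset ε hε0
    refine ⟨_, ⟨ψ, hψ, rfl⟩, fun i hi => ?_⟩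
    rw [Metric.mem_ball, dist_eq_norm]
    exact (h i (hI.mem_toFinset.2 hi)).trans (hε i hi)

theorem IsInnerAut.isApproxInner {φ : A ≃⋆ₐ[ℂ] A} (hφ : IsInnerAut φ) : IsApproxInner φ :=
  isApproxInner_iff.2 fun _ _ hε => ⟨φ, hφ, fun x _ => by simpa using hε⟩

theorem isApproxInner_of_approx {φ : A ≃⋆ₐ[ℂ] A}
    (h : ∀ (F : Finset A) (ε : ℝ), 0 < ε → ∃ ψ, IsApproxInner ψ ∧ ∀ x ∈ F, ‖ψ x - φ x‖ < ε) :
    IsApproxInner φ := by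
  refine isApproxInner_iff.2 fun F ε hε => ?_
  obtain ⟨ψ, hψ, h1⟩ := h F (ε / 2) (half_pos hε)
  obtain ⟨χ, hχ, h2⟩ := isApproxInner_iff.1 hψ F (ε / 2) (half_pos hε)
  refine ⟨χ, hχ, fun x hx => ?_⟩
  calc _ ≤ ‖χ x - ψ x‖ + ‖ψ x - φ x‖ := norm_sub_le_norm_sub_add_norm_sub _ _ _
    _ < ε := by linarith [h1 x hx, h2 x hx]

theorem IsApproxInner.mul {φ ψ : A ≃⋆ₐ[ℂ] A} (hφ : IsApproxInner φ) (hψ : IsApproxInner ψ) :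
    IsApproxInner (φ * ψ) := by
  classical
  refine isApproxInner_iff.2 fun F ε hε => ?_
  obtain ⟨χ, hχ, h1⟩ := isApproxInner_iff.1 hφ (F.image ψ) (ε / 2) (half_pos hε)
  obtain ⟨ω, hω, h2⟩ := isApproxInner_iff.1 hψ F (ε / 2) (half_pos hε)
  refine ⟨χ * ω, hχ.mul hω, fun x hx => ?_⟩
  have h3 := h1 (ψ x) (Finset.mem_image_of_mem _ hx)
  have h4 := h2 x hx
  rw [← norm_aut_apply χ, map_sub] at h4
  rw [StarAlgEquiv.mul_apply, StarAlgEquiv.mul_apply]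
  calc _ ≤ ‖χ (ω x) - χ (ψ x)‖ + ‖χ (ψ x) - φ (ψ x)‖ := norm_sub_le_norm_sub_add_norm_sub _ _ _
    _ < ε := by linarith

theorem IsApproxInner.inv {φ : A ≃⋆ₐ[ℂ] A} (hφ : IsApproxInner φ) : IsApproxInner φ⁻¹ := by
  classical
  refine isApproxInner_iff.2 fun F ε hε => ?_
  obtain ⟨χ, hχ, h1⟩ := isApproxInner_iff.1 hφ (F.image (φ⁻¹ : A ≃⋆ₐ[ℂ] A)) ε hε
  refine ⟨χ⁻¹, hχ.inv, fun x hx => ?_⟩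
  have h2 := h1 (φ⁻¹ x) (Finset.mem_image_of_mem _ hx)
  rw [norm_aut_inv_sub, norm_sub_rev]
  rwa [aut_apply_inv] at h2

theorem IsApproxInner.conj {φ : A ≃⋆ₐ[ℂ] A} (hφ : IsApproxInner φ) (ψ : A ≃⋆ₐ[ℂ] A) :
    IsApproxInner (ψ * φ * ψ⁻¹) := by
  classical
  refine isApproxInner_iff.2 fun F ε hε => ?_
  obtain ⟨χ, hχ, h1⟩ := isApproxInner_iff.1 hφ (F.image (ψ⁻¹ : A ≃⋆ₐ[ℂ] A)) ε hε
  refine ⟨_, hχ.conj ψ, fun x hx => ?_⟩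
  have h2 := h1 (ψ⁻¹ x) (Finset.mem_image_of_mem _ hx)
  rwa [← norm_aut_apply ψ, map_sub] at h2

end InnerAut

/-! ### The corner `A` of `A ⊗ 𝕂` and almost stable rank one -/

/-- A separable C⋆-algebra has a sequential approximate unit of self-adjoint contractions. -/
theorem exists_seq_approxUnit (A : Type u) [NonUnitalCStarAlgebra A]
    [TopologicalSpace.SeparableSpace A] :
    ∃ k : ℕ → A, (∀ n, star (k n) = k n) ∧ (∀ n, ‖k n‖ ≤ 1) ∧
      ∀ a, Tendsto (fun n => k n * a) atTop (𝓝 a) := by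
  let _ := CStarAlgebra.spectralOrder A
  have := CStarAlgebra.spectralOrderedRing A
  have hl := CStarAlgebra.increasingApproximateUnit A
  have := hl.neBot
  have hex : ∀ n : ℕ, ∃ k : A, star k = k ∧ ‖k‖ ≤ 1 ∧
      ∀ i ∈ Finset.range n, ‖k * TopologicalSpace.denseSeq A i - TopologicalSpace.denseSeq A i‖
        < 1 / ((n : ℝ) + 1) := fun n => by
    refine (hl.eventually_star_eq.and (hl.eventually_norm.and
      ((Filter.eventually_all_finset _).2 fun i _ => ?_))).exists
    have := (hl.tendsto_mul_right (TopologicalSpace.denseSeq A i)).eventually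
      (Metric.ball_mem_nhds _ (ε := 1 / ((n : ℝ) + 1)) (by positivity))
    simpa [dist_eq_norm] using this
  choose k hk1 hk2 hk3 using hex
  refine ⟨k, hk1, hk2, fun a => Metric.tendsto_atTop.2 fun ε hε => ?_⟩
  obtain ⟨b, ⟨i, rfl⟩, hb⟩ := Metric.mem_closure_iff.1
    ((TopologicalSpace.denseRange_denseSeq A) a) (ε / 3) (by positivity)
  rw [dist_eq_norm] at hb
  obtain ⟨N, hN⟩ := exists_nat_one_div_lt (show 0 < ε / 3 by positivity)
  refine ⟨max N (i + 1), fun n hn => ?_⟩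
  have h1 := hk3 n i (Finset.mem_range.2 (lt_of_lt_of_le (Nat.lt_succ_self i)
    ((le_max_right _ _).trans hn)))
  have h2 : 1 / ((n : ℝ) + 1) ≤ 1 / ((N : ℝ) + 1) :=
    one_div_le_one_div_of_le (by positivity) (by
      have : (N : ℝ) ≤ n := by exact_mod_cast (le_max_left _ _).trans hn
      linarith)
  generalize TopologicalSpace.denseSeq A i = b at *
  rw [dist_eq_norm]
  have h3 : ‖k n * (a - b)‖ ≤ ‖a - b‖ :=
    (norm_mul_le _ _).trans (mul_le_of_le_one_left (norm_nonneg _) (hk2 n))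
  calc ‖k n * a - a‖ = ‖k n * (a - b) + (k n * b - b) - (a - b)‖ := by congr 1; noncomm_ring
    _ ≤ ‖k n * (a - b)‖ + ‖k n * b - b‖ + ‖a - b‖ :=
      (norm_sub_le _ _).trans (add_le_add_left (norm_add_le _ _) _)
    _ < ε := by linarith

/-- A positive element dominated by an element of the corner of a projection lies in the corner. -/
theorem eq_conj_of_nonneg_of_le {D : Type*} [CStarAlgebra D] [PartialOrder D] [StarOrderedRing D]
    {P b x : D} (hP : star P = P) (hPP : P * P = P) (hb : P * b * P = b) (h0 : 0 ≤ x)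
    (hle : x ≤ b) : x = P * x * P := by
  have hstar : star (1 - P) = 1 - P := by rw [star_sub, star_one, hP]
  -- Compression by `1 - P` kills `b`, hence also `x`. Writing `x = s⋆s` gives `s(1 - P) = 0`.
  have hQ : star (1 - P) * b * (1 - P) = 0 := by
    rw [hstar, ← hb]
    calc _ = (P - P * P) * b * (P - P * P) := by noncomm_ring
      _ = 0 := by rw [hPP]; simp
  have hx0 : star (1 - P) * x * (1 - P) = 0 :=
    le_antisymm ((star_left_conjugate_le_conjugate hle _).trans hQ.le)
      (star_left_conjugate_nonneg h0 _)
  obtain ⟨s, rfl⟩ := CStarAlgebra.nonneg_iff_eq_star_mul_self.1 h0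
  have hs : s * (1 - P) = 0 := by
    rw [← CStarRing.star_mul_self_eq_zero_iff, ← hx0, star_mul]
    noncomm_ring
  have h1 : s * P = s := by
    rw [mul_sub, mul_one, sub_eq_zero] at hs
    exact hs.symm
  have h2 : P * star s = star s := by
    have := congrArg star h1
    rwa [star_mul, hP] at this
  rw [← mul_assoc, h2, mul_assoc, h1]

/-- The unital extension of `f` to the unitization is continuous and preserves invertibility. This
transfers approximation by invertibles from the unitization to `M(A)`. -/
theorem SubsetClosureGL.map_mem_closure {B M : Type*} [NonUnitalCStarAlgebra B] [CStarAlgebra M]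
    (h : SubsetClosureGL B) (f : B →⋆ₙₐ[ℂ] M) (b : B) : f b ∈ closure {z : M | IsUnit z} := by
  have hf : Continuous (Unitization.starLift f) :=
    AddMonoidHomClass.continuous_of_bound _ 1 fun x => by
      rw [one_mul]; exact NonUnitalStarAlgHom.norm_apply_le _ x
  have h1 := image_closure_subset_closure_image hf ⟨_, h b, rfl⟩
  have h2 : Unitization.starLift f (b : Unitization ℂ B) = f b := by
    rw [← Unitization.starLift_symm_apply_apply, Equiv.symm_apply_apply]
  rw [h2] at h1
  refine closure_mono ?_ h1
  rintro _ ⟨z, hz, rfl⟩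
  exact IsUnit.map _ hz

section Corner

variable {A : Type u} [NonUnitalCStarAlgebra A]
  {H : Type u} [NormedAddCommGroup H] [InnerProductSpace ℂ H] [CompleteSpace H]

theorem tensorMatrixUnit_apply (π : A →⋆ₙₐ[ℂ] (H →L[ℂ] H)) (a : A) (i j : ℕ)
    (ξ : lp (fun _ : ℕ => H) 2) :
    tensorMatrixUnit π a i j ξ = lp.single 2 i (π a (ξ j)) := rfl

theorem tensorMatrixUnit_inner (π : A →⋆ₙₐ[ℂ] (H →L[ℂ] H)) (a : A) (i j : ℕ)
    (ξ η : lp (fun _ : ℕ => H) 2) :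
    inner ℂ (tensorMatrixUnit π (star a) j i ξ) η = inner ℂ ξ (tensorMatrixUnit π a i j η) := by
  rw [tensorMatrixUnit_apply, tensorMatrixUnit_apply, lp.inner_single_left, lp.inner_single_right,
    map_star, ContinuousLinearMap.star_eq_adjoint, ContinuousLinearMap.adjoint_inner_left]

theorem tensorMatrixUnit_star (π : A →⋆ₙₐ[ℂ] (H →L[ℂ] H)) (a : A) (i j : ℕ) :
    star (tensorMatrixUnit π a i j) = tensorMatrixUnit π (star a) j i := by
  rw [ContinuousLinearMap.star_eq_adjoint, eq_comm, ContinuousLinearMap.eq_adjoint_iff]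
  exact tensorMatrixUnit_inner π a i j

theorem tensorMatrixUnit_mul (π : A →⋆ₙₐ[ℂ] (H →L[ℂ] H)) (a b : A) (i j k : ℕ) :
    tensorMatrixUnit π a i j * tensorMatrixUnit π b j k = tensorMatrixUnit π (a * b) i k := by
  ext ξ : 1
  simp [tensorMatrixUnit_apply]

/-- The embedding of `A` as the upper left corner of `A ⊗ 𝕂`. -/
noncomputable def cornerHom (π : A →⋆ₙₐ[ℂ] (H →L[ℂ] H)) :
    A →⋆ₙₐ[ℂ] (lp (fun _ : ℕ => H) 2 →L[ℂ] lp (fun _ : ℕ => H) 2) where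
  toFun a := tensorMatrixUnit π a 0 0
  map_zero' := by ext ξ : 1; simp [tensorMatrixUnit_apply]
  map_add' a b := by ext ξ : 1; simp [tensorMatrixUnit_apply, lp.single_add]
  map_smul' c a := by ext ξ : 1; simp [tensorMatrixUnit_apply, lp.single_smul]
  map_mul' a b := (tensorMatrixUnit_mul π a b 0 0 0).symm
  map_star' a := (tensorMatrixUnit_star π a 0 0).symm

theorem cornerHom_injective {π : A →⋆ₙₐ[ℂ] (H →L[ℂ] H)} (hπ : Function.Injective π) :
    Function.Injective (cornerHom π) := by
  refine (injective_iff_map_eq_zero _).2 fun a ha => (injective_iff_map_eq_zero π).1 hπ a ?_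
  ext v
  have := congrArg (fun T : lp (fun _ : ℕ => H) 2 →L[ℂ] lp (fun _ : ℕ => H) 2 =>
    (T (lp.single 2 0 v)) 0) ha
  simpa [cornerHom, tensorMatrixUnit_apply] using this

/-- The projection of `ℓ²(ℕ, H)` onto the first coordinate. -/
noncomputable def firstProj (H : Type u) [NormedAddCommGroup H] [InnerProductSpace ℂ H] :
    lp (fun _ : ℕ => H) 2 →L[ℂ] lp (fun _ : ℕ => H) 2 :=
  lp.singleContinuousLinearMap ℂ (fun _ : ℕ => H) 2 0 ∘L lp.evalCLM ℂ (fun _ : ℕ => H) 2 0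

omit [CompleteSpace H] in
theorem firstProj_apply (ξ : lp (fun _ : ℕ => H) 2) : firstProj H ξ = lp.single 2 0 (ξ 0) := rfl

theorem star_firstProj : star (firstProj H) = firstProj H := by
  rw [ContinuousLinearMap.star_eq_adjoint, eq_comm, ContinuousLinearMap.eq_adjoint_iff]
  intro ξ η
  rw [firstProj_apply, firstProj_apply, lp.inner_single_left, lp.inner_single_right]

omit [CompleteSpace H] in
theorem firstProj_mul_self : firstProj H * firstProj H = firstProj H := by
  ext ξ : 1
  simp [firstProj_apply]

theorem firstProj_conj_cornerHom (π : A →⋆ₙₐ[ℂ] (H →L[ℂ] H)) (a : A) :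
    firstProj H * cornerHom π a * firstProj H = cornerHom π a := by
  ext ξ : 1
  simp [firstProj_apply, cornerHom, tensorMatrixUnit_apply]

theorem tensorMatrixUnit_mul_of_ne (π : A →⋆ₙₐ[ℂ] (H →L[ℂ] H)) (a b : A) {i j k l : ℕ}
    (h : j ≠ k) : tensorMatrixUnit π a i j * tensorMatrixUnit π b k l = 0 := by
  ext ξ : 1
  simp [tensorMatrixUnit_apply, h]

theorem firstProj_conj_tensorMatrixUnit_mem (π : A →⋆ₙₐ[ℂ] (H →L[ℂ] H)) (a : A) (i j : ℕ) :
    firstProj H * tensorMatrixUnit π a i j * firstProj H ∈ NonUnitalStarAlgHom.range (cornerHom π)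
    := by
  by_cases hi : i = 0
  · by_cases hj : j = 0
    · subst hi hj
      exact ⟨a, (firstProj_conj_cornerHom π a).symm⟩
    · refine ⟨0, ?_⟩
      ext ξ : 1
      simp [firstProj_apply, tensorMatrixUnit_apply, hj]
  · refine ⟨0, ?_⟩
    ext ξ : 1
    simp [firstProj_apply, tensorMatrixUnit_apply, Pi.single_apply, Ne.symm hi]

/-- Compression to the corner is linear but not multiplicative, so checking it on generators
requires a linear spanning set. The matrix units supply one, their products and adjoints being again
matrix units or zero. -/
theorem adjoin_tensorMatrixUnit_le_span (π : A →⋆ₙₐ[ℂ] (H →L[ℂ] H))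
    {T : lp (fun _ : ℕ => H) 2 →L[ℂ] lp (fun _ : ℕ => H) 2}
    (hT : T ∈ NonUnitalStarAlgebra.adjoin ℂ
      {T | ∃ (a : A) (i j : ℕ), T = tensorMatrixUnit π a i j}) :
    T ∈ Submodule.span ℂ {T | ∃ (a : A) (i j : ℕ), T = tensorMatrixUnit π a i j} := by
  induction hT using NonUnitalStarAlgebra.adjoin_induction with
  | mem x hx => exact Submodule.subset_span hx
  | add x y _ _ hx hy => exact add_mem hx hy
  | zero => exact zero_mem _
  | smul r x _ hx => exact Submodule.smul_mem _ r hx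
  | mul x y h1 h2 hx hy =>
    clear h1 h2
    induction hx, hy using Submodule.span_induction₂ with
    | mem_mem x y hx hy =>
      obtain ⟨a, i, j, rfl⟩ := hx
      obtain ⟨b, k, l, rfl⟩ := hy
      by_cases h : j = k
      · subst h
        exact Submodule.subset_span ⟨a * b, i, l, tensorMatrixUnit_mul ..⟩
      · rw [tensorMatrixUnit_mul_of_ne π a b h]
        exact zero_mem _
    | zero_left y _ => simp
    | zero_right x _ => simp
    | add_left x y z _ _ _ h1 h2 => rw [add_mul]; exact add_mem h1 h2
    | add_right x y z _ _ _ h1 h2 => rw [mul_add]; exact add_mem h1 h2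
    | smul_left r x y _ _ h => rw [smul_mul_assoc]; exact Submodule.smul_mem _ r h
    | smul_right r x y _ _ h => rw [mul_smul_comm]; exact Submodule.smul_mem _ r h
  | star x h1 hx =>
    clear h1
    induction hx using Submodule.span_induction with
    | mem x hx =>
      obtain ⟨a, i, j, rfl⟩ := hx
      exact Submodule.subset_span ⟨star a, j, i, tensorMatrixUnit_star ..⟩
    | zero => simp
    | add x y _ _ h1 h2 => rw [star_add]; exact add_mem h1 h2
    | smul r x _ h => rw [star_smul]; exact Submodule.smul_mem _ _ h

theorem isClosed_range_cornerHom {π : A →⋆ₙₐ[ℂ] (H →L[ℂ] H)} (hπ : Function.Injective π) :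
    IsClosed (NonUnitalStarAlgHom.range (cornerHom π) :
      Set (lp (fun _ : ℕ => H) 2 →L[ℂ] lp (fun _ : ℕ => H) 2)) := by
  rw [NonUnitalStarAlgHom.coe_range]
  exact (NonUnitalStarAlgHom.isometry (cornerHom π)
    (cornerHom_injective hπ)).isClosedEmbedding.isClosed_range

theorem firstProj_conj_mem_range {π : A →⋆ₙₐ[ℂ] (H →L[ℂ] H)} (hπ : Function.Injective π)
    {T : lp (fun _ : ℕ => H) 2 →L[ℂ] lp (fun _ : ℕ => H) 2} (hT : T ∈ stabilization π) :
    firstProj H * T * firstProj H ∈ NonUnitalStarAlgHom.range (cornerHom π) := by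
  have hc : IsClosed {T : lp (fun _ : ℕ => H) 2 →L[ℂ] lp (fun _ : ℕ => H) 2 |
      firstProj H * T * firstProj H ∈ NonUnitalStarAlgHom.range (cornerHom π)} :=
    (isClosed_range_cornerHom hπ).preimage (f := fun T => firstProj H * T * firstProj H)
      (by fun_prop)
  refine closure_minimal (fun T hT => ?_) hc hT
  have hT' := adjoin_tensorMatrixUnit_le_span π hT
  clear hT
  change firstProj H * T * firstProj H ∈ NonUnitalStarAlgHom.range (cornerHom π)
  induction hT' using Submodule.span_induction with
  | mem x hx =>
    obtain ⟨a, i, j, rfl⟩ := hx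
    exact firstProj_conj_tensorMatrixUnit_mem π a i j
  | zero => rw [mul_zero, zero_mul]; exact zero_mem _
  | add x y _ _ h1 h2 => rw [mul_add, add_mul]; exact add_mem h1 h2
  | smul r x _ h => rw [mul_smul_comm, smul_mul_assoc]; exact SMulMemClass.smul_mem r h

theorem isHereditaryIn_range_cornerHom {π : A →⋆ₙₐ[ℂ] (H →L[ℂ] H)} (hπ : Function.Injective π) :
    IsHereditaryIn (stabilization π) (NonUnitalStarAlgHom.range (cornerHom π)) where
  le := by
    rintro _ ⟨a, rfl⟩
    exact subset_closure (NonUnitalStarAlgebra.subset_adjoin ℂ _ ⟨a, 0, 0, rfl⟩)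
  isClosed := isClosed_range_cornerHom hπ
  mem_of_le := by
    rintro x hx _ ⟨a, rfl⟩ h0 hle
    rw [eq_conj_of_nonneg_of_le star_firstProj firstProj_mul_self
      (firstProj_conj_cornerHom π a) h0 hle]
    exact firstProj_conj_mem_range hπ hx

theorem isSigmaUnital_range_cornerHom [TopologicalSpace.SeparableSpace A]
    {π : A →⋆ₙₐ[ℂ] (H →L[ℂ] H)} (hπ : Function.Injective π) :
    IsSigmaUnital (NonUnitalStarAlgHom.range (cornerHom π)) := by
  obtain ⟨k, hk, hk1, hka⟩ := exists_seq_approxUnit A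
  have hc : Continuous (cornerHom π) :=
    (NonUnitalStarAlgHom.isometry (cornerHom π) (cornerHom_injective hπ)).continuous
  have h1 : ∀ a, Tendsto (fun n => k n * k n * a) atTop (𝓝 a) := fun a => by
    have : AsympEq (fun n => k n * a) (fun _ => a) := by
      simpa [AsympEq] using (hka a).sub_const a
    have h2 := (this.mul_left ⟨1, hk1⟩).trans this
    simpa [AsympEq, mul_assoc] using Tendsto.add_const a h2
  -- The `k n` are only known to be self-adjoint; squaring makes them positive.
  refine ⟨fun n => cornerHom π (k n * k n), fun n => ⟨⟨_, rfl⟩, ?_, ?_⟩, ?_⟩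
  · change 0 ≤ cornerHom π (k n * k n)
    nth_rewrite 1 [← hk n]
    rw [map_mul, map_star]
    exact star_mul_self_nonneg _
  · rw [NonUnitalStarAlgHom.norm_map _ (cornerHom_injective hπ)]
    exact (norm_mul_le _ _).trans (mul_le_one₀ (hk1 n) (norm_nonneg _) (hk1 n))
  · rintro _ ⟨a, rfl⟩
    refine ⟨?_, ?_⟩
    · change Tendsto (fun n => cornerHom π (k n * k n) * cornerHom π a) _ (𝓝 (cornerHom π a))
      simp only [← map_mul]
      exact (hc.tendsto a).comp (h1 a)
    · have h2 := (h1 (star a)).star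
      simp only [star_mul, star_star, hk] at h2
      change Tendsto (fun n => cornerHom π a * cornerHom π (k n * k n)) _ (𝓝 (cornerHom π a))
      simp only [← map_mul]
      exact (hc.tendsto a).comp h2

end Corner

/-- In the multiplier algebra of a separable C⋆-algebra `A` of almost stable rank one, the elements
of `A` are limits of invertible elements. -/
theorem AlmostStableRankOne.coe_mem_closure {A : Type u} [NonUnitalCStarAlgebra A]
    [TopologicalSpace.SeparableSpace A] (hA : AlmostStableRankOne A) (a : A) :
    DoubleCentralizer.coe ℂ a ∈ closure {z : 𝓜(ℂ, A) | IsUnit z} := by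
  obtain ⟨H, _, _, _, π, hπ, h⟩ := hA
  have hB := isHereditaryIn_range_cornerHom hπ
  have h := h _ hB (isSigmaUnital_range_cornerHom hπ)
  have := hB.isClosed
  let e : A ≃⋆ₐ[ℂ] NonUnitalStarAlgHom.range (cornerHom π) :=
    StarAlgEquiv.ofInjective' (cornerHom π) (cornerHom_injective hπ)
  have h1 := h.map_mem_closure ((DoubleCentralizer.coeHom (𝕜 := ℂ) (A := A)).comp
    (e.symm : NonUnitalStarAlgHom.range (cornerHom π) →⋆ₙₐ[ℂ] A)) (e a)
  have h2 : e.symm (e a) = a := e.symm_apply_apply a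
  change DoubleCentralizer.coe ℂ (e.symm (e a)) ∈ _ at h1
  rwa [h2] at h1

/-! ### Sequences representing the Rohlin projections -/

namespace CentralSequence

variable {A : Type u} [NonUnitalCStarAlgebra A]

/-- The class of a bounded sequence in `A^∞`. -/
noncomputable def mkSeq (x : BddSeq A) : SeqAlg A := (x : (c0 A).ringCon.Quotient)

/-- The class of a central sequence in `F(A)`. -/
noncomputable def mkF (x : Comm A) : F A := (x : (Ann A).ringCon.Quotient)

theorem mkSeq_surjective : Function.Surjective (mkSeq : BddSeq A → SeqAlg A) :=
  Quotient.exists_rep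

theorem mkF_surjective : Function.Surjective (mkF : Comm A → F A) := Quotient.exists_rep

theorem mkSeq_eq_iff {x y : BddSeq A} : mkSeq x = mkSeq y ↔ AsympEq x y := by
  unfold mkSeq
  rw [RingCon.eq, (c0 A).rel_iff, mem_c0, AsympEq]
  exact tendsto_zero_iff_norm_tendsto_zero.symm

theorem mkF_eq_iff {x y : Comm A} :
    mkF x = mkF y ↔ ∀ b, (x : SeqAlg A) * const b = (y : SeqAlg A) * const b := by
  unfold mkF
  rw [RingCon.eq, (Ann A).rel_iff, mem_Ann]
  refine forall_congr' fun b => ?_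
  rw [AddSubgroupClass.coe_sub, sub_mul, sub_eq_zero]

theorem mkF_sum {ι : Type*} (s : Finset ι) (x : ι → Comm A) :
    ∑ i ∈ s, mkF (x i) = mkF (∑ i ∈ s, x i) :=
  (map_sum ({ toFun := mkF, map_zero' := rfl, map_add' := fun _ _ => rfl } :
    Comm A →+ F A) x s).symm

theorem mkSeq_sum {ι : Type*} (s : Finset ι) (x : ι → BddSeq A) :
    ∑ i ∈ s, mkSeq (x i) = mkSeq (∑ i ∈ s, x i) :=
  (map_sum ({ toFun := mkSeq, map_zero' := rfl, map_add' := fun _ _ => rfl } :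
    BddSeq A →+ SeqAlg A) x s).symm

theorem mkSeq_mul (x y : BddSeq A) : mkSeq (x * y) = mkSeq x * mkSeq y := rfl

theorem const_eq (a : A) : const a = mkSeq (constSeq a) := rfl

theorem normBdd (x : BddSeq A) : NormBdd (fun n => x n) :=
  ⟨‖x‖, lp.norm_apply_le_norm ENNReal.top_ne_zero x⟩

end CentralSequence

/-- A family of bounded sequences representing an equivariant partition of unity in `F(A)`. -/
structure IsRohlinSeq {A : Type u} [NonUnitalCStarAlgebra A] {G : Type*} [Group G] [Fintype G]
    (β : G →* (A ≃⋆ₐ[ℂ] A)) (e : G → ℕ → A) : Prop where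
  bdd : ∀ g, NormBdd (e g)
  comm : ∀ g a, AsympEq (fun n => e g n * a) (fun n => a * e g n)
  selfAdjoint : ∀ g a, AsympEq (fun n => star (e g n) * a) (fun n => e g n * a)
  idem : ∀ g a, AsympEq (fun n => e g n * (e g n * a)) (fun n => e g n * a)
  orth : ∀ g h a, g ≠ h → AsympEq (fun n => e g n * (e h n * a)) (fun _ => 0)
  sum : ∀ a, AsympEq (fun n => ∑ g, e g n * a) (fun _ => a)
  equivariant : ∀ g h a, AsympEq (fun n => β g (e h n) * a) (fun n => e (g * h) n * a)

-- Equality in `F(A)` means equality in `A^∞` after multiplication by each constant `a`, so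
-- arbitrary lifts satisfy the relations asymptotically in that weakened form. No lifting of
-- projections is needed.
open CentralSequence in
theorem HasRohlinProperty.exists_isRohlinSeq {A : Type u} [NonUnitalCStarAlgebra A]
    [TopologicalSpace.SeparableSpace A] {G : Type*} [Group G] [Fintype G]
    {β : G →* (A ≃⋆ₐ[ℂ] A)} (hβ : HasRohlinProperty β) : ∃ e, IsRohlinSeq β e := by
  obtain ⟨e, he, horth, hsum, heq⟩ := hβ
  choose x hx using fun g => mkF_surjective (e g)
  obtain rfl : (fun g => mkF (x g)) = e := funext hx
  choose s hs using fun g => mkSeq_surjective (x g : SeqAlg A)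
  obtain ⟨k, hk, hk1, hka⟩ := exists_seq_approxUnit A
  have hkl : ∀ a, AsympEq (fun n => k n * a) (fun _ => a) := fun a => by
    simpa [AsympEq] using (hka a).sub_const a
  have hkr : ∀ a, AsympEq (fun n => a * k n) (fun _ => a) := fun a => by
    simpa [hk] using (hkl (star a)).star
  let k' : BddSeq A := ⟨k, memℓp_infty_iff.2 ⟨1, by rintro _ ⟨n, rfl⟩; exact hk1 n⟩⟩
  -- The partition of unity is only known to act as an identity on `F(A)`. Testing it on the class
  -- of an approximate unit, which acts trivially on `A`, yields the sum relation on `A` itself.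
  let κ : Comm A := ⟨mkSeq k', by
    refine NonUnitalSubring.mem_centralizer_iff.2 ?_
    rintro _ ⟨a, rfl⟩
    exact mkSeq_eq_iff.2 ((hkr a).trans (hkl a).symm)⟩
  have hbs : NormBdd fun n => ∑ g, s g n := NormBdd.sum _ fun g _ => normBdd (s g)
  refine ⟨fun g n => s g n, fun g => normBdd (s g), fun g a => ?_, fun g a => ?_, fun g a => ?_,
    fun g h a hgh => ?_, fun a => ?_, fun g h a => ?_⟩
  · have := const_mul_comm (x g) a
    rw [← hs, const_eq, ← mkSeq_mul, ← mkSeq_mul] at this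
    exact (mkSeq_eq_iff.1 this).symm
  · have := (mkF_eq_iff (x := star (x g))).1 (he g).isSelfAdjoint a
    change star (x g : SeqAlg A) * _ = _ at this
    rw [← hs] at this
    exact (mkSeq_eq_iff (x := star (s g) * constSeq a) (y := s g * constSeq a)).1 this
  · have := (mkF_eq_iff (x := x g * x g)).1 (he g).isIdempotentElem a
    change (x g : SeqAlg A) * x g * const a = _ at this
    rw [← hs, mul_assoc] at this
    exact (mkSeq_eq_iff (x := s g * (s g * constSeq a)) (y := s g * constSeq a)).1 this
  · have := (mkF_eq_iff (x := x g * x h) (y := 0)).1 (horth g h hgh) a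
    change (x g : SeqAlg A) * x h * const a = 0 * _ at this
    rw [← hs, ← hs, mul_assoc, zero_mul] at this
    exact (mkSeq_eq_iff (x := s g * (s h * constSeq a)) (y := 0)).1 this
  · have := (hsum (mkF κ)).1
    rw [mkF_sum] at this
    have := (mkF_eq_iff (x := (∑ g, x g) * κ)).1 this a
    change ((∑ g, x g : Comm A) : SeqAlg A) * mkSeq k' * const a = mkSeq k' * const a at this
    rw [AddSubmonoidClass.coe_finsetSum] at this
    simp only [← hs] at this
    rw [mkSeq_sum, mul_assoc] at this
    have := (mkSeq_eq_iff (x := (∑ g, s g) * (k' * constSeq a)) (y := k' * constSeq a)).1 this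
    have h2 : AsympEq (fun n => (∑ g, s g n) * (k n * a)) (fun n => k n * a) := by
      refine .trans (.of_eq fun n => ?_) this
      simp only [lp.infty_coeFn_mul, Pi.mul_apply, lp.coeFn_sum, Finset.sum_apply]
      rfl
    refine .trans ?_ (h2.trans (hkl a))
    refine .trans (.of_eq fun n => Finset.sum_mul _ _ _ |>.symm) ((hkl a).symm.mul_left hbs)
  · have := (mkF_eq_iff (x := mapComm (β g) (x h))).1 (heq g h) a
    change mapSeqAlg (β g) (x h) * _ = _ at this
    rw [← hs, ← hs] at this
    exact (mkSeq_eq_iff (x := mapBddSeq (β g) (s h) * constSeq a)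
      (y := s (g * h) * constSeq a)).1 this

/-! ### Gluing along a partition of unity -/

namespace IsRohlinSeq

open DoubleCentralizer

variable {A : Type u} [NonUnitalCStarAlgebra A] {G : Type*} [Group G] [Fintype G]
  {β : G →* (A ≃⋆ₐ[ℂ] A)} {e : G → ℕ → A}

theorem normBdd_coe (he : IsRohlinSeq β e) (g : G) :
    NormBdd fun n => DoubleCentralizer.coe ℂ (e g n) :=
  (he.bdd g).imp fun C h n => by rw [norm_coe]; exact h n

theorem asympEq_coe {f g : ℕ → A} (h : AsympEq f g) :
    AsympEq (fun n => DoubleCentralizer.coe ℂ (f n)) (fun n => DoubleCentralizer.coe ℂ (g n)) :=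
  h.map (φ := coeHom (𝕜 := ℂ) (A := A)) continuous_coe

theorem coe_comm (he : IsRohlinSeq β e) (g : G) (a : A) :
    AsympEq (fun n => DoubleCentralizer.coe ℂ (e g n) * DoubleCentralizer.coe ℂ a)
      (fun n => DoubleCentralizer.coe ℂ a * DoubleCentralizer.coe ℂ (e g n)) := by
  simpa only [coe_mul] using asympEq_coe (he.comm g a)

theorem coe_selfAdjoint (he : IsRohlinSeq β e) (g : G) (a : A) :
    AsympEq (fun n => star (DoubleCentralizer.coe ℂ (e g n)) * DoubleCentralizer.coe ℂ a)
      (fun n => DoubleCentralizer.coe ℂ (e g n) * DoubleCentralizer.coe ℂ a) := by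
  simpa only [coe_mul, coe_star] using asympEq_coe (he.selfAdjoint g a)

theorem coe_sum (he : IsRohlinSeq β e) (a : A) :
    AsympEq (fun n => ∑ g, DoubleCentralizer.coe ℂ (e g n) * DoubleCentralizer.coe ℂ a)
      (fun _ => DoubleCentralizer.coe ℂ a) := by
  simpa only [coe_mul, DoubleCentralizer.coe_sum] using asympEq_coe (he.sum a)

open Classical in
theorem coe_mul_coe (he : IsRohlinSeq β e) (g h : G) (a : A) :
    AsympEq (fun n => DoubleCentralizer.coe ℂ (e g n) *
        (DoubleCentralizer.coe ℂ (e h n) * DoubleCentralizer.coe ℂ a))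
      (fun n => if g = h then DoubleCentralizer.coe ℂ (e g n) * DoubleCentralizer.coe ℂ a
        else 0) := by
  split_ifs with hgh
  · subst hgh
    simpa only [coe_mul] using asympEq_coe (he.idem g a)
  · have := asympEq_coe (he.orth g h a hgh)
    simp only [coe_mul] at this
    exact this.trans (.of_eq fun _ => map_zero (coeHom (𝕜 := ℂ) (A := A)))

open Classical in
theorem coe_mul_mul_star (he : IsRohlinSeq β e) (g h : G) (a : A) :
    AsympEq (fun n => DoubleCentralizer.coe ℂ (e g n) * (DoubleCentralizer.coe ℂ a *
        star (DoubleCentralizer.coe ℂ (e h n))))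
      (fun n => if g = h then DoubleCentralizer.coe ℂ (e g n) * DoubleCentralizer.coe ℂ a
        else 0) := by
  refine .trans (.mul_left ?_ (he.normBdd_coe g)) (he.coe_mul_coe g h a)
  refine .trans ?_ (he.coe_comm h a).symm
  have := (he.coe_selfAdjoint h (star a)).star.symm
  simpa only [star_mul, coe_star, star_star] using this

open Classical in
theorem star_coe_mul_mul (he : IsRohlinSeq β e) (g h : G) (a : A) :
    AsympEq (fun n => star (DoubleCentralizer.coe ℂ (e g n)) * (DoubleCentralizer.coe ℂ (e h n) *
        DoubleCentralizer.coe ℂ a))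
      (fun n => if g = h then DoubleCentralizer.coe ℂ (e g n) * DoubleCentralizer.coe ℂ a
        else 0) := by
  refine .trans ?_ (he.coe_mul_coe g h a)
  refine .trans ((he.coe_comm h a).mul_left (he.normBdd_coe g).star) ?_
  refine .trans ?_ ((he.coe_comm h a).symm.mul_left (he.normBdd_coe g))
  simpa only [mul_assoc] using (he.coe_selfAdjoint g a).mul_right (he.normBdd_coe h)

/-- Unitary multipliers can be glued along a partition of unity in `F(A)` if the elements of `A` are
limits of invertible multipliers. -/
theorem exists_unitary (he : IsRohlinSeq β e)
    (hA : ∀ a : A, DoubleCentralizer.coe ℂ a ∈ closure {z : 𝓜(ℂ, A) | IsUnit z})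
    (u : G → 𝓜(ℂ, A)) (hu : ∀ g, u g ∈ unitary 𝓜(ℂ, A)) :
    ∃ U : ℕ → 𝓜(ℂ, A), (∀ n, U n ∈ unitary 𝓜(ℂ, A)) ∧ ∀ a : A,
      AsympEq (fun n => U n * DoubleCentralizer.coe ℂ a * star (U n))
        (fun n => ∑ g, DoubleCentralizer.coe ℂ (e g n) *
          (u g * DoubleCentralizer.coe ℂ a * star (u g))) := by
  classical
  set z : ℕ → 𝓜(ℂ, A) := fun n => ∑ g, DoubleCentralizer.coe ℂ (e g n) * u g with hz
  have hzA : ∀ n, z n ∈ closure {z : 𝓜(ℂ, A) | IsUnit z} := fun n => by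
    convert hA (∑ g, (u g).snd (e g n))
    rw [DoubleCentralizer.coe_sum]
    exact Finset.sum_congr rfl fun g _ => coe_mul' _ _
  have hzb : NormBdd z := NormBdd.sum _ fun g _ => (he.normBdd_coe g).mul (.const _)
  have hzz : ∀ a : A, AsympEq (fun n => star (z n) * z n * DoubleCentralizer.coe ℂ a)
      (fun _ => DoubleCentralizer.coe ℂ a) := fun a => by
    -- Orthogonality removes the off-diagonal terms of the double sum; on the diagonal, centrality
    -- brings `star (u g)` next to `u g`.
    have h1 : AsympEq (fun n => star (z n) * z n * DoubleCentralizer.coe ℂ a)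
        (fun n => ∑ g, ∑ h, star (u g) * (if g = h then DoubleCentralizer.coe ℂ (e g n) *
          DoubleCentralizer.coe ℂ ((u h).fst a) else 0)) := by
      refine .trans (.of_eq fun n => ?_) (.sum _ fun g _ => .sum _ fun h _ =>
        (he.star_coe_mul_mul g h ((u h).fst a)).mul_left (.const (star (u g))))
      simp only [hz, star_sum, Finset.mul_sum, Finset.sum_mul, star_mul, ← mul_coe, mul_assoc]
      exact Finset.sum_comm
    refine h1.trans (.trans (.sum _ fun g _ => ?_) (he.coe_sum a))
    simp only [mul_ite, mul_zero, Finset.sum_ite_eq, Finset.mem_univ, if_true]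
    refine .trans ((he.coe_comm g ((u g).fst a)).mul_left (.const _)) ?_
    refine .trans (.of_eq fun n => ?_) (he.coe_comm g a).symm
    rw [← mul_coe, ← mul_assoc, ← mul_assoc, (Unitary.mem_iff.1 (hu g)).1, one_mul]
  obtain ⟨U, hU, hUz⟩ := exists_unitary_asympEq_conj hzA hzb
  refine ⟨U, hU, fun a => (hUz _ (hzz a) (by simpa only [coe_star] using hzz (star a))).trans ?_⟩
  have h1 : AsympEq (fun n => z n * DoubleCentralizer.coe ℂ a * star (z n))
      (fun n => ∑ g, ∑ h, if g = h then DoubleCentralizer.coe ℂ (e g n) *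
        DoubleCentralizer.coe ℂ ((star (u h)).snd ((u g).fst a)) else 0) := by
    refine .trans (.of_eq fun n => ?_) (.sum _ fun g _ => .sum _ fun h _ =>
      he.coe_mul_mul_star g h ((star (u h)).snd ((u g).fst a)))
    simp only [hz, star_sum, Finset.mul_sum, Finset.sum_mul, star_mul, coe_snd_fst, mul_assoc]
    exact Finset.sum_comm
  refine h1.trans (.of_eq fun n => ?_)
  simp only [Finset.sum_ite_eq, Finset.mem_univ, if_true, coe_snd_fst]

/-- Approximately inner automorphisms can be glued, up to `ε` on a finite set, to an inner
automorphism along a partition of unity in `F(A)`. -/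
theorem eventually_exists_isInnerAut (he : IsRohlinSeq β e)
    (hA : ∀ a : A, DoubleCentralizer.coe ℂ a ∈ closure {z : 𝓜(ℂ, A) | IsUnit z})
    (φ : G → (A ≃⋆ₐ[ℂ] A)) (hφ : ∀ g, IsApproxInner (φ g)) (F : Finset A) {ε : ℝ} (hε : 0 < ε) :
    ∀ᶠ n in atTop, ∃ ψ : A ≃⋆ₐ[ℂ] A, IsInnerAut ψ ∧
      ∀ a ∈ F, ‖ψ a - ∑ g, e g n * φ g a‖ < ε := by
  choose C hC using he.bdd
  have hC0 : ∀ g, 0 ≤ C g := fun g => (norm_nonneg _).trans (hC g 0)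
  set K := ∑ g, C g with hK
  have hK0 : 0 ≤ K := Finset.sum_nonneg fun g _ => hC0 g
  -- Replacing `φ g` by an inner automorphism costs at most `K` times this tolerance, hence at most
  -- `ε / 2`; the `+ 1` allows `K = 0`.
  have hδ : 0 < ε / (2 * (K + 1)) := by positivity
  choose χ hχ hχφ using fun g => isApproxInner_iff.1 (hφ g) F _ hδ
  choose u hu huχ using hχ
  obtain ⟨U, hU, hUe⟩ := he.exists_unitary hA u hu
  have : ∀ᶠ n in atTop, ∀ a ∈ F, ‖U n * DoubleCentralizer.coe ℂ a * star (U n) -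
      ∑ g, DoubleCentralizer.coe ℂ (e g n) *
        (u g * DoubleCentralizer.coe ℂ a * star (u g))‖ < ε / 2 :=
    (eventually_all_finset F).2 fun a _ => by
      have := (hUe a).eventually (Metric.ball_mem_nhds 0 (half_pos hε))
      simpa using this
  filter_upwards [this] with n hn
  refine ⟨Ad (U n) (hU n), isInnerAut_Ad _ _, fun a ha => ?_⟩
  have h1 := hn a ha
  simp only [← huχ, ← coe_Ad (U n) (hU n), ← coe_mul, ← DoubleCentralizer.coe_sum, ← coe_sub,
    norm_coe] at h1
  have h2 : ‖∑ g, e g n * χ g a - ∑ g, e g n * φ g a‖ ≤ K * (ε / (2 * (K + 1))) := by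
    rw [← Finset.sum_sub_distrib, hK, Finset.sum_mul]
    refine norm_sum_le_of_le _ fun g _ => ?_
    rw [← mul_sub]
    exact (norm_mul_le _ _).trans
      (mul_le_mul (hC g n) (hχφ g a ha).le (norm_nonneg _) (hC0 g))
  have h3 : K * (ε / (2 * (K + 1))) ≤ ε / 2 := by
    rw [mul_div_assoc', div_le_div_iff₀ (by positivity) (by positivity)]
    nlinarith
  calc _ ≤ _ := norm_sub_le_norm_sub_add_norm_sub _ (∑ g, e g n * χ g a) _
    _ < ε := by linarith

end IsRohlinSeq

/-! ### Averaging and the intertwining defect -/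

section Intertwining

variable {A : Type u} [NonUnitalCStarAlgebra A] {G : Type*} [Group G] [Fintype G]

/-- The failure of `θ` to intertwine the actions `α` and `β` at `x`. -/
noncomputable def intertwiningDefect (α β : G →* (A ≃⋆ₐ[ℂ] A)) (θ : A ≃⋆ₐ[ℂ] A) (x : A) : ℝ :=
  ∑ g, ‖θ (α g x) - β g (θ x)‖

variable {α β : G →* (A ≃⋆ₐ[ℂ] A)}

theorem intertwiningDefect_nonneg (θ : A ≃⋆ₐ[ℂ] A) (x : A) : 0 ≤ intertwiningDefect α β θ x :=
  Finset.sum_nonneg fun _ _ => norm_nonneg _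

theorem norm_le_intertwiningDefect (θ : A ≃⋆ₐ[ℂ] A) (x : A) (g : G) :
    ‖θ (α g x) - β g (θ x)‖ ≤ intertwiningDefect α β θ x :=
  Finset.single_le_sum (f := fun g => ‖θ (α g x) - β g (θ x)‖) (fun _ _ => norm_nonneg _)
    (Finset.mem_univ g)

omit [Fintype G] in
theorem hom_inv_apply (α : G →* (A ≃⋆ₐ[ℂ] A)) (g : G) (x : A) : (α g)⁻¹ x = α g⁻¹ x := by
  rw [map_inv]

omit [Fintype G] in
theorem hom_mul_apply (α : G →* (A ≃⋆ₐ[ℂ] A)) (g h : G) (x : A) :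
    α g (α h x) = α (g * h) x := by
  rw [map_mul, StarAlgEquiv.mul_apply]

theorem sum_norm_conj_sub_eq (θ : A ≃⋆ₐ[ℂ] A) (x : A) :
    ∑ h, ‖β h (θ (α h⁻¹ x)) - θ x‖ = intertwiningDefect α β θ x := by
  rw [intertwiningDefect, ← Equiv.sum_comp (Equiv.inv G)]
  refine Finset.sum_congr rfl fun h _ => ?_
  have := norm_aut_apply (β h⁻¹) (θ (α h x) - β h (θ x))
  rw [map_sub, hom_mul_apply, inv_mul_cancel, map_one, StarAlgEquiv.one_apply] at this
  rw [Equiv.inv_apply, inv_inv, this]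

/-- Substitute `h⁻¹` for `h` and use that automorphisms are isometric. The left side is the bound
that averaging gives for the displacement of `θ⁻¹`. -/
theorem sum_norm_conj_inv_sub_eq (θ : A ≃⋆ₐ[ℂ] A) (x : A) :
    ∑ h, ‖β h (θ (α h⁻¹ (θ⁻¹ x))) - x‖ = intertwiningDefect β α θ⁻¹ x := by
  rw [intertwiningDefect, ← Equiv.sum_comp (Equiv.inv G)]
  refine Finset.sum_congr rfl fun h _ => ?_
  have := norm_aut_apply (β h⁻¹) (β h x - θ (α h (θ⁻¹ x)))
  rw [map_sub, hom_mul_apply, inv_mul_cancel, map_one, StarAlgEquiv.one_apply] at this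
  rw [Equiv.inv_apply, inv_inv, norm_aut_inv_sub, norm_sub_rev, this]

-- A product of a conjugate of `θ`, the inverse of `α_h β_h⁻¹`, and `θ⁻¹`; this is where approximate
-- unitary equivalence of the actions enters.
omit [Fintype G] in
theorem isApproxInner_conj (hαβ : ∀ g, IsApproxUnitarilyEquiv (α g) (β g)) {θ : A ≃⋆ₐ[ℂ] A}
    (hθ : IsApproxInner θ) (h : G) : IsApproxInner (β h * θ * (α h)⁻¹ * θ⁻¹) := by
  have : β h * θ * (α h)⁻¹ * θ⁻¹ = (β h * θ * (β h)⁻¹) * (α h * (β h)⁻¹)⁻¹ * θ⁻¹ := by group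
  rw [this]
  exact ((hθ.conj _).mul (IsApproxInner.inv (hαβ h))).mul hθ.inv

/-- Averaging along a partition of unity in `F(A)` replaces `θ` by an approximately inner
automorphism that nearly intertwines the actions; it moves `θ` by no more than the intertwining
defect of `θ`. -/
theorem IsRohlinSeq.exists_intertwining {e : G → ℕ → A} (he : IsRohlinSeq β e)
    (hA : ∀ a : A, DoubleCentralizer.coe ℂ a ∈ closure {z : 𝓜(ℂ, A) | IsUnit z})
    (hαβ : ∀ g, IsApproxUnitarilyEquiv (α g) (β g)) :
    ∃ C : ℝ, 0 ≤ C ∧ ∀ (θ : A ≃⋆ₐ[ℂ] A), IsApproxInner θ → ∀ (F : Finset A) (ε : ℝ), 0 < ε →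
      ∃ θ' : A ≃⋆ₐ[ℂ] A, IsApproxInner θ' ∧ ∀ x ∈ F,
        (∀ g, ‖θ' (α g x) - β g (θ' x)‖ < ε) ∧
        ‖θ' x - θ x‖ ≤ ε + C * intertwiningDefect α β θ x ∧
        ‖θ'⁻¹ x - θ⁻¹ x‖ ≤ ε + C * intertwiningDefect β α θ⁻¹ x := by
  classical
  choose C hC using he.bdd
  have hC0 : ∀ g, 0 ≤ C g := fun g => (norm_nonneg _).trans (hC g 0)
  set K := ∑ g, C g with hK
  have hCK : ∀ g, C g ≤ K := fun g =>
    Finset.single_le_sum (fun g _ => hC0 g) (Finset.mem_univ g)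
  refine ⟨K, Finset.sum_nonneg fun g _ => hC0 g, fun θ hθ F ε hε => ?_⟩
  have hδ : 0 < ε / 4 := by positivity
  set φ : G → (A ≃⋆ₐ[ℂ] A) := fun h => β h * θ * (α h)⁻¹ * θ⁻¹ with hφ
  have hφ_apply : ∀ h y, φ h y = β h (θ (α h⁻¹ (θ⁻¹ y))) := fun h y => by
    simp only [hφ, StarAlgEquiv.mul_apply, hom_inv_apply]
  have hφθ : ∀ h y, φ h (θ y) = β h (θ (α h⁻¹ y)) := fun h y => by
    rw [hφ_apply, aut_inv_apply]
  have ev1 := he.eventually_exists_isInnerAut hA φ (isApproxInner_conj hαβ hθ)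
    -- The points of `F` serve the displacement of `θ⁻¹`, those of `θ(F)` the displacement of `θ`,
    -- and those of `θ(α_g F)`, together with `θ(F)`, the intertwining estimate.
    (F ∪ F.image θ ∪ Finset.univ.biUnion fun g => F.image fun x => θ (α g x)) hδ
  have ev2 : ∀ y, ∀ᶠ n in atTop, ‖∑ g, e g n * y - y‖ < ε / 4 := fun y => by
    simpa using (he.sum y).eventually (Metric.ball_mem_nhds 0 hδ)
  have ev3 : ∀ (g : G) (x : A), ∀ᶠ n in atTop,
      ‖∑ h, β g (e h n) * β g (φ h (θ x)) - ∑ h, e (g * h) n * β g (φ h (θ x))‖ < ε / 4 :=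
    fun g x => by
      have := AsympEq.sum Finset.univ fun h _ => he.equivariant g h (β g (φ h (θ x)))
      simpa using Tendsto.eventually this (Metric.ball_mem_nhds 0 hδ)
  obtain ⟨n, ⟨ψ, hψ, h1⟩, h2, h2', h3⟩ := (ev1.and
    (((eventually_all_finset F).2 fun x _ => ev2 x).and
      (((eventually_all_finset F).2 fun x _ => ev2 (θ x)).and
        ((eventually_all_finset F).2 fun x _ => eventually_all.2 fun g => ev3 g x)))).exists
  have move : ∀ y, ‖ψ y - ∑ g, e g n * φ g y‖ < ε / 4 → ‖∑ g, e g n * y - y‖ < ε / 4 →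
      ‖ψ y - y‖ ≤ ε + K * ∑ h, ‖φ h y - y‖ := fun y hy hy' => by
    have : ‖∑ g, e g n * φ g y - ∑ g, e g n * y‖ ≤ K * ∑ h, ‖φ h y - y‖ := by
      rw [← Finset.sum_sub_distrib, Finset.mul_sum]
      refine norm_sum_le_of_le _ fun g _ => ?_
      rw [← mul_sub]
      exact (norm_mul_le _ _).trans
        (mul_le_mul_of_nonneg_right ((hC g n).trans (hCK g)) (norm_nonneg _))
    have h4 := norm_sub_le_norm_sub_add_norm_sub (ψ y) (∑ g, e g n * φ g y) y
    have h5 := norm_sub_le_norm_sub_add_norm_sub (∑ g, e g n * φ g y) (∑ g, e g n * y) y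
    linarith
  refine ⟨ψ * θ, hψ.isApproxInner.mul hθ, fun x hx => ⟨fun g => ?_, ?_, ?_⟩⟩
  · rw [StarAlgEquiv.mul_apply, StarAlgEquiv.mul_apply]
    have h4 := h1 (θ (α g x)) (Finset.mem_union_right _ (Finset.mem_biUnion.2
      ⟨g, Finset.mem_univ g, Finset.mem_image_of_mem _ hx⟩))
    have h5 := h1 (θ x) (Finset.mem_union_left _ (Finset.mem_union_right _
      (Finset.mem_image_of_mem _ hx)))
    rw [← norm_aut_apply (β g), map_sub, map_sum] at h5
    simp only [map_mul (β g)] at h5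
    have h6 := h3 x hx g
    -- Equivariance of the average: `β_g φ_h(θ x) = φ_{gh}(θ α_g x)`, and `h ↦ gh` permutes `G`.
    have h7 : ∑ h, e (g * h) n * β g (φ h (θ x)) = ∑ h, e h n * φ h (θ (α g x)) := by
      rw [← Equiv.sum_comp (Equiv.mulLeft g) fun h => e h n * φ h (θ (α g x))]
      refine Finset.sum_congr rfl fun h _ => ?_
      rw [Equiv.coe_mulLeft, hφθ, hφθ, hom_mul_apply, hom_mul_apply, mul_inv_rev, mul_assoc,
        inv_mul_cancel, mul_one]
    rw [h7] at h6
    rw [norm_sub_rev] at h5 h6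
    have h8 := norm_sub_le_norm_sub_add_norm_sub (ψ (θ (α g x)))
      (∑ h, e h n * φ h (θ (α g x))) (β g (ψ (θ x)))
    have h9 := norm_sub_le_norm_sub_add_norm_sub (∑ h, e h n * φ h (θ (α g x)))
      (∑ h, β g (e h n) * β g (φ h (θ x))) (β g (ψ (θ x)))
    linarith
  · have := move (θ x) (h1 _ (Finset.mem_union_left _ (Finset.mem_union_right _
      (Finset.mem_image_of_mem _ hx)))) (h2' x hx)
    simp only [hφθ] at this
    rwa [sum_norm_conj_sub_eq] at this
  · have := move x (h1 _ (Finset.mem_union_left _ (Finset.mem_union_left _ hx))) (h2 x hx)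
    simp only [hφ_apply] at this
    rw [sum_norm_conj_inv_sub_eq] at this
    -- As `(ψθ)⁻¹ = θ⁻¹ψ⁻¹`, the displacement of the inverse at `x` equals `‖ψ x - x‖`.
    rwa [mul_inv_rev, StarAlgEquiv.mul_apply, ← map_sub, norm_aut_apply, norm_aut_inv_sub,
      norm_sub_rev]

end Intertwining

section Intertwining

variable {A : Type u} [NonUnitalCStarAlgebra A] {G : Type*} [Group G] [Fintype G]
  {α β : G →* (A ≃⋆ₐ[ℂ] A)}

/-- Compare `β_g θ α_k x` with `β_{gk} θ x`: each `g` costs one defect at `k`, and the remaining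
terms are those of the defect at `x`, permuted. -/
theorem intertwiningDefect_apply_le (θ : A ≃⋆ₐ[ℂ] A) (x : A) (k : G) :
    intertwiningDefect α β θ (α k x) ≤ (1 + Fintype.card G) * intertwiningDefect α β θ x := by
  have h1 : intertwiningDefect α β θ (α k x) ≤
      ∑ g, (‖θ (α (g * k) x) - β (g * k) (θ x)‖ + intertwiningDefect α β θ x) := by
    refine Finset.sum_le_sum fun g _ => ?_
    have h2 := norm_le_intertwiningDefect (α := α) (β := β) θ x k
    rw [norm_sub_rev, ← norm_aut_apply (β g), map_sub, hom_mul_apply] at h2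
    rw [hom_mul_apply]
    exact (norm_sub_le_norm_sub_add_norm_sub _ _ _).trans (add_le_add_right h2 _)
  have h2 := Equiv.sum_comp (Equiv.mulRight k) (fun g => ‖θ (α g x) - β g (θ x)‖)
  simp only [Equiv.coe_mulRight] at h2
  rw [Finset.sum_add_distrib, h2] at h1
  simp only [Finset.sum_const, Finset.card_univ, nsmul_eq_mul] at h1
  rw [add_mul, one_mul]
  exact h1

theorem intertwiningDefect_le_of_close {θ θ' : A ≃⋆ₐ[ℂ] A} {x : A} {η : ℝ}
    (h : ∀ g, ‖θ' (α g x) - θ (α g x)‖ ≤ η) :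
    intertwiningDefect α β θ' x ≤ intertwiningDefect α β θ x + 2 * Fintype.card G * η := by
  have h1 : ‖θ' x - θ x‖ ≤ η := by simpa using h 1
  calc intertwiningDefect α β θ' x ≤ ∑ g, (‖θ (α g x) - β g (θ x)‖ + 2 * η) := by
        refine Finset.sum_le_sum fun g _ => ?_
        have h2 := norm_sub_le_norm_sub_add_norm_sub (θ' (α g x)) (θ (α g x)) (β g (θ' x))
        have h3 := norm_sub_le_norm_sub_add_norm_sub (θ (α g x)) (β g (θ x)) (β g (θ' x))
        rw [norm_sub_rev, ← norm_aut_apply (β g), map_sub] at h1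
        linarith [h g]
    _ = _ := by
        rw [Finset.sum_add_distrib]
        simp only [Finset.sum_const, Finset.card_univ, nsmul_eq_mul, intertwiningDefect]
        ring

theorem intertwiningDefect_le_card_mul {θ : A ≃⋆ₐ[ℂ] A} {x : A} {η : ℝ}
    (h : ∀ g, ‖θ (α g x) - β g (θ x)‖ < η) :
    intertwiningDefect α β θ x ≤ Fintype.card G * η := by
  refine (Finset.sum_le_sum fun g _ => (h g).le).trans ?_
  simp

/-- Two averagings, along partitions of unity for `β` and for `α`, make both intertwining defects
small. -/
theorem exists_approx_intertwining {e f : G → ℕ → A} (he : IsRohlinSeq β e)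
    (hf : IsRohlinSeq α f)
    (hA : ∀ a : A, DoubleCentralizer.coe ℂ a ∈ closure {z : 𝓜(ℂ, A) | IsUnit z})
    (hαβ : ∀ g, IsApproxUnitarilyEquiv (α g) (β g)) :
    ∃ C : ℝ, 0 ≤ C ∧ ∀ (θ : A ≃⋆ₐ[ℂ] A), IsApproxInner θ → ∀ (F : Finset A) (ε : ℝ), 0 < ε →
      ∃ θ' : A ≃⋆ₐ[ℂ] A, IsApproxInner θ' ∧ ∀ x ∈ F,
        intertwiningDefect α β θ' x ≤ ε ∧ intertwiningDefect β α θ'⁻¹ x ≤ ε ∧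
        ‖θ' x - θ x‖ ≤ ε + C * intertwiningDefect α β θ x ∧
        ‖θ'⁻¹ x - θ⁻¹ x‖ ≤ ε + C * intertwiningDefect β α θ⁻¹ x := by
  classical
  have hβα : ∀ g, IsApproxUnitarilyEquiv (β g) (α g) := fun g => by
    have := IsApproxInner.inv (hαβ g)
    rwa [mul_inv_rev, inv_inv] at this
  obtain ⟨C₁, hC₁, H₁⟩ := he.exists_intertwining hA hαβ
  obtain ⟨C₂, hC₂, H₂⟩ := hf.exists_intertwining hA hβα
  obtain ⟨m, hm⟩ : ∃ m : ℝ, m = Fintype.card G := ⟨_, rfl⟩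
  have hm0 : 0 ≤ m := hm ▸ Nat.cast_nonneg _
  -- The first averaging moves `θ⁻¹` by `C₁` times its defect `d` and can raise that defect to `(1 +
  -- 2m C₁(1 + m)) d`, up to multiples of `δ`; the second then moves by `C₂` times this. The
  -- constant `L` below dominates the coefficient of `δ` in each of the four estimates.
  refine ⟨C₁ + C₂ * (1 + 2 * m * (C₁ * (1 + m))), by positivity, fun θ hθ F ε hε => ?_⟩
  obtain ⟨L, hL⟩ : ∃ L : ℝ, L = 2 + 3 * m + 2 * m * (C₂ * m) + C₂ * (2 * m) := ⟨_, rfl⟩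
  have hL0 : 0 < L := by rw [hL]; positivity
  obtain ⟨δ, hδ⟩ : ∃ δ, δ = ε / L := ⟨_, rfl⟩
  have hδ0 : 0 < δ := hδ ▸ by positivity
  have hδL : δ * L = ε := by rw [hδ]; field_simp
  rw [hL] at hδL
  -- Bounding how the defect at `x` changes requires control of displacements at all translates of
  -- `x`.
  set F₁ : Finset A := (Finset.univ.biUnion fun g => F.image (α g)) ∪
    Finset.univ.biUnion fun g => F.image (β g) with hF₁
  have hαF : ∀ x ∈ F, ∀ g, α g x ∈ F₁ := fun x hx g => Finset.mem_union_left _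
    (Finset.mem_biUnion.2 ⟨g, Finset.mem_univ g, Finset.mem_image_of_mem _ hx⟩)
  have hβF : ∀ x ∈ F, ∀ g, β g x ∈ F₁ := fun x hx g => Finset.mem_union_right _
    (Finset.mem_biUnion.2 ⟨g, Finset.mem_univ g, Finset.mem_image_of_mem _ hx⟩)
  have hF : ∀ x ∈ F, x ∈ F₁ := fun x hx => by simpa using hαF x hx 1
  obtain ⟨θ', hθ', h1⟩ := H₁ θ hθ F₁ δ hδ0
  obtain ⟨χ, hχ, h2⟩ := H₂ θ'⁻¹ hθ'.inv F₁ δ hδ0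
  simp only [inv_inv] at h2
  have hD1 : ∀ x ∈ F₁, intertwiningDefect α β θ' x ≤ m * δ := fun x hx =>
    hm ▸ intertwiningDefect_le_card_mul (h1 x hx).1
  have hD2 : ∀ x ∈ F₁, intertwiningDefect β α χ x ≤ m * δ := fun x hx =>
    hm ▸ intertwiningDefect_le_card_mul (h2 x hx).1
  -- The second averaging hardly moves `θ'`, whose defect is already of order `δ`; hence the gain of
  -- the first averaging survives.
  have hclose : ∀ x ∈ F₁, ‖χ⁻¹ x - θ' x‖ ≤ δ + C₂ * (m * δ) := fun x hx =>
    (h2 x hx).2.2.trans (by gcongr; exact hD1 x hx)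
  refine ⟨χ⁻¹, hχ.inv, fun x hx => ⟨?_, ?_, ?_, ?_⟩⟩
  · have := intertwiningDefect_le_of_close (α := α) (β := β) (θ := θ') (θ' := χ⁻¹) (x := x)
      fun g => hclose _ (hαF x hx g)
    rw [← hm] at this
    have h3 := hD1 x (hF x hx)
    have h4 : 0 ≤ C₂ * (2 * m) * δ := by positivity
    nlinarith
  · rw [inv_inv]
    have h4 : 0 ≤ C₂ * (2 * m) * δ := by positivity
    have h5 : 0 ≤ m * (C₂ * m) * δ := by positivity
    have h6 : 0 ≤ m * δ := by positivity
    linarith [hD2 x (hF x hx)]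
  · have h3 := norm_sub_le_norm_sub_add_norm_sub (χ⁻¹ x) (θ' x) (θ x)
    have h4 := hclose x (hF x hx)
    have h5 := (h1 x (hF x hx)).2.1
    have h6 : 0 ≤ C₂ * (1 + 2 * m * (C₁ * (1 + m))) * intertwiningDefect α β θ x :=
      mul_nonneg (by positivity) (intertwiningDefect_nonneg _ _)
    have h7 : 0 ≤ m * (C₂ * m) * δ := by positivity
    have h8 : 0 ≤ m * δ := by positivity
    have h9 : 0 ≤ C₂ * m * δ := by positivity
    linarith
  · rw [inv_inv]
    set d := intertwiningDefect β α θ⁻¹ x with hd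
    have hd0 : 0 ≤ d := intertwiningDefect_nonneg _ _
    have h3 := norm_sub_le_norm_sub_add_norm_sub (χ x) (θ'⁻¹ x) (θ⁻¹ x)
    have h4 := (h2 x (hF x hx)).2.1
    have h5 := (h1 x (hF x hx)).2.2
    have h6 : intertwiningDefect β α θ'⁻¹ x ≤ d + 2 * m * (δ + C₁ * ((1 + m) * d)) := by
      rw [hm]
      refine intertwiningDefect_le_of_close fun g => (h1 _ (hβF x hx g)).2.2.trans ?_
      gcongr
      exact intertwiningDefect_apply_le _ _ _
    have h7 := mul_le_mul_of_nonneg_left h6 hC₂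
    have h8 : 0 ≤ m * (C₂ * m) * δ := by positivity
    have h9 : 0 ≤ m * δ := by positivity
    linarith

end Intertwining

/-! ### Pointwise limits of automorphisms and the conclusion -/

section Limit

variable {A : Type u} [NonUnitalCStarAlgebra A]

theorem cauchySeq_aut_apply {θ : ℕ → (A ≃⋆ₐ[ℂ] A)} {s : Set A} (hs : Dense s)
    (h : ∀ a ∈ s, CauchySeq fun n => θ n a) (x : A) : CauchySeq fun n => θ n x := by
  refine Metric.cauchySeq_iff'.2 fun ε hε => ?_
  obtain ⟨a, ha, hxa⟩ := Metric.mem_closure_iff.1 (hs x) (ε / 3) (by positivity)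
  obtain ⟨N, hN⟩ := Metric.cauchySeq_iff'.1 (h a ha) (ε / 3) (by positivity)
  refine ⟨N, fun n hn => ?_⟩
  have h1 := hN n hn
  rw [dist_eq_norm] at h1 hxa ⊢
  have h2 : ∀ k, ‖θ k x - θ k a‖ < ε / 3 := fun k => by rwa [← map_sub, norm_aut_apply]
  have h3 := norm_sub_le_norm_sub_add_norm_sub (θ n x) (θ n a) (θ N x)
  have h4 := norm_sub_le_norm_sub_add_norm_sub (θ n a) (θ N a) (θ N x)
  have h5 := h2 N
  rw [norm_sub_rev] at h5
  linarith [h2 n]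

/-- Pointwise limits of automorphisms whose inverses also converge pointwise are automorphisms. -/
theorem exists_aut_tendsto {θ : ℕ → (A ≃⋆ₐ[ℂ] A)} (h : ∀ x, CauchySeq fun n => θ n x)
    (h' : ∀ x, CauchySeq fun n => (θ n)⁻¹ x) :
    ∃ Θ : A ≃⋆ₐ[ℂ] A, ∀ x, Tendsto (fun n => θ n x) atTop (𝓝 (Θ x)) := by
  choose T hT using fun x => cauchySeq_tendsto_of_complete (h x)
  choose S hS using fun x => cauchySeq_tendsto_of_complete (h' x)
  refine ⟨{ toFun := T, invFun := S, left_inv := fun x => ?_, right_inv := fun x => ?_,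
            map_mul' := fun x y => ?_, map_add' := fun x y => ?_, map_star' := fun x => ?_,
            map_smul' := fun c x => ?_ }, hT⟩
  -- Since each `θ n` is isometric, `‖(θ n)⁻¹ (T x) - x‖ = ‖T x - θ n x‖`, which tends to zero.
  · refine tendsto_nhds_unique (hS (T x)) (tendsto_iff_norm_sub_tendsto_zero.2 ?_)
    refine (tendsto_iff_norm_sub_tendsto_zero.1 (hT x)).congr fun n => ?_
    rw [norm_aut_inv_sub, norm_sub_rev]
  · refine tendsto_nhds_unique (hT (S x)) (tendsto_iff_norm_sub_tendsto_zero.2 ?_)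
    refine (tendsto_iff_norm_sub_tendsto_zero.1 (hS x)).congr fun n => ?_
    rw [norm_aut_inv_sub, norm_sub_rev]
  · exact tendsto_nhds_unique (hT _) (by simpa using (hT x).mul (hT y))
  · exact tendsto_nhds_unique (hT _) (by simpa using (hT x).add (hT y))
  · exact tendsto_nhds_unique (hT _) (by simpa [map_star] using (hT x).star)
  · exact tendsto_nhds_unique (hT _) (by simpa using (hT x).const_smul c)

end Limit

theorem theorem3p5 {A : Type u} [NonUnitalCStarAlgebra A] [TopologicalSpace.SeparableSpace A]
    (hA : AlmostStableRankOne A) {G : Type*} [Group G] [Fintype G]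
    (α β : G →* (A ≃⋆ₐ[ℂ] A)) (hα : HasRohlinProperty α) (hβ : HasRohlinProperty β)
    (hαβ : ∀ g, IsApproxUnitarilyEquiv (α g) (β g)) :
    ∃ θ : A ≃⋆ₐ[ℂ] A, IsApproxInner θ ∧ ∀ g, θ * α g * θ⁻¹ = β g := by
  classical
  obtain ⟨f, hf⟩ := hα.exists_isRohlinSeq
  obtain ⟨e, he⟩ := hβ.exists_isRohlinSeq
  obtain ⟨C, hC, H⟩ := exists_approx_intertwining he hf hA.coe_mem_closure hαβ
  set a := TopologicalSpace.denseSeq A with ha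
  have hdense : Dense (Set.range a) := TopologicalSpace.denseRange_denseSeq A
  choose! step hstep hstep' using fun (θ : A ≃⋆ₐ[ℂ] A) (hθ : IsApproxInner θ) (n : ℕ) =>
    H θ hθ ((Finset.range (n + 1)).image a) ((1 / 2) ^ n) (by positivity)
  -- The sequence begins with one step applied to the identity automorphism, so the defect bounds
  -- already hold at `n = 0`. Stage `n` controls `a 0, …, a n`, hence `a i` from stage `i` on.
  let θ : ℕ → (A ≃⋆ₐ[ℂ] A) := fun n =>
    Nat.rec (step 1 0) (fun n χ => step χ (n + 1)) n
  have hθ : ∀ n, IsApproxInner (θ n) := fun n => by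
    induction n with
    | zero => exact hstep 1 IsInnerAut.one.isApproxInner 0
    | succ n ih => exact hstep (θ n) ih (n + 1)
  have hmem : ∀ {i n : ℕ}, i ≤ n → a i ∈ (Finset.range (n + 1)).image a := fun h =>
    Finset.mem_image_of_mem _ (Finset.mem_range.2 (Nat.lt_succ_of_le h))
  have hdef : ∀ i n, i ≤ n → intertwiningDefect α β (θ n) (a i) ≤ (1 / 2) ^ n ∧
      intertwiningDefect β α (θ n)⁻¹ (a i) ≤ (1 / 2) ^ n := fun i n hin => by
    cases n with
    | zero =>
      have := hstep' 1 IsInnerAut.one.isApproxInner 0 (a i) (hmem hin)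
      exact ⟨this.1, this.2.1⟩
    | succ n =>
      have := hstep' (θ n) (hθ n) (n + 1) (a i) (hmem hin)
      exact ⟨this.1, this.2.1⟩
  have hclose : ∀ i n, i ≤ n → ‖θ (n + 1) (a i) - θ n (a i)‖ ≤ (1 + C) * (1 / 2) ^ n ∧
      ‖(θ (n + 1))⁻¹ (a i) - (θ n)⁻¹ (a i)‖ ≤ (1 + C) * (1 / 2) ^ n := fun i n hin => by
    have h1 := (hstep' (θ n) (hθ n) (n + 1) (a i) (hmem (hin.trans n.le_succ))).2.2
    have h2 := hdef i n hin
    have h3 : ((1 : ℝ) / 2) ^ (n + 1) ≤ (1 / 2) ^ n :=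
      pow_le_pow_of_le_one (by norm_num) (by norm_num) n.le_succ
    have h4 := mul_le_mul_of_nonneg_left h2.1 hC
    have h5 := mul_le_mul_of_nonneg_left h2.2 hC
    rw [add_mul, one_mul]
    exact ⟨h1.1.trans (add_le_add h3 h4), h1.2.trans (add_le_add h3 h5)⟩
  have hcauchy : ∀ (u : ℕ → A) (i : ℕ),
      (∀ n, i ≤ n → ‖u (n + 1) - u n‖ ≤ (1 + C) * (1 / 2) ^ n) → CauchySeq u := fun u i h => by
    refine (cauchySeq_shift i).1 (cauchySeq_of_le_geometric (1 / 2) (1 + C) (by norm_num)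
      fun n => ?_)
    rw [dist_comm, dist_eq_norm, add_right_comm]
    refine (h (n + i) (Nat.le_add_left _ _)).trans ?_
    gcongr _ * ?_
    exact pow_le_pow_of_le_one (by norm_num) (by norm_num) (Nat.le_add_right _ _)
  obtain ⟨Θ, hΘ⟩ := exists_aut_tendsto (θ := θ)
    (cauchySeq_aut_apply hdense (by
      rintro _ ⟨i, rfl⟩
      exact hcauchy _ i fun n hn => (hclose i n hn).1))
    (cauchySeq_aut_apply (θ := fun n => (θ n)⁻¹) hdense (by
      rintro _ ⟨i, rfl⟩
      exact hcauchy _ i fun n hn => (hclose i n hn).2))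
  refine ⟨Θ, isApproxInner_of_approx fun F ε hε => ?_, fun g => ?_⟩
  · have : ∀ᶠ n in atTop, ∀ x ∈ F, ‖θ n x - Θ x‖ < ε :=
      (eventually_all_finset F).2 fun x _ => by
        have := (hΘ x).eventually (Metric.ball_mem_nhds _ hε)
        simpa [dist_eq_norm] using this
    obtain ⟨n, hn⟩ := this.exists
    exact ⟨θ n, hθ n, hn⟩
  · have hfun : (fun x => Θ (α g x)) = fun x => β g (Θ x) := by
      refine Continuous.ext_on hdense ((continuous_aut _).comp (continuous_aut _))
        ((continuous_aut _).comp (continuous_aut _)) ?_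
      rintro _ ⟨i, rfl⟩
      -- The intertwining error of the limit at `a i` is the limit of the errors of `θ n`, which are
      -- at most `(1 / 2) ^ n` once `n ≥ i`.
      have h1 := (hΘ (α g (a i))).sub (((continuous_aut (β g)).tendsto _).comp (hΘ (a i)))
      refine sub_eq_zero.1 (tendsto_nhds_unique h1 ?_)
      refine squeeze_zero_norm' (a := fun n => (1 / 2 : ℝ) ^ n) ?_
        (tendsto_pow_atTop_nhds_zero_of_lt_one (by norm_num) (by norm_num))
      filter_upwards [eventually_ge_atTop i] with n hn
      exact (norm_le_intertwiningDefect (θ n) (a i) g).trans (hdef i n hn).1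
    rw [mul_inv_eq_iff_eq_mul]
    exact StarAlgEquiv.ext fun x => congrFun hfun x
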